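/- Let $m$ be a $\sigma$-finite measure on a measurable space $X$, and let $\mathcal E$ be a (symmetric) Dirichlet form on the real space $L^2(m)$, with associated nonnegative self-adjoint operator $L$ and Markovian semigroup $T_t=e^{-tL}$, $t\ge 0$. For $1\le p\le\infty$ the semigroup extends consistently from $L^p(m)\cap L^2(m)$ to $L^p(m)$ (as a bounded operator for $p<\infty$, and as a weak-$*$-continuous operator for $p=\infty$). For $1\le p<\infty$ let $L_p$ be the generator of the resulting $C_0$-semigroup on $L^p(m)$, and call $f\in L^p(m)$ *$L_p$-harmonic* if $f\in D(L_p)$ and $L_pf=0$. Call $\mathcal E$ *irreducible* if every measurable set $A$ with $T_t(1_Ag)=1_AT_tg$ for all $g\in L^2(m)$, $t\ge0$, satisfies $m(A)=0$ or $m(X\setminus A)=0$, and *conservative* if $T_t1=1$ for all $t\ge 0$. Suppose that $\mathcal E$ is irreducible, and let $1<p<\infty$. If $0$ is not an eigenvalue of $L$, put $\Phi=0$; otherwise there is a unique positive constant eigenfunction $\Phi\in L^2(m)$ of $L$ to the eigenvalue $0$ with $\|\Phi\|_2=1$. Then every $L_p$-harmonic function $f\in L^p(m)$ is constant ($m$-a.e.),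 and more precisely $$ f=(\Phi,f)\,\Phi=\begin{cases}\dfrac1{m(X)}\displaystyle\int_X f\,dm & \text{if } m(X)<\infty \text{ and } \mathcal E \text{ is conservative},\\[1ex] 0 & \text{otherwise,}\end{cases} \qquad (\Phi,f)=\int_X \Phi f\,dm . $$ In particular, if there is an $L_p$-harmonic function $f\neq 0$, then $m(X)<\infty$. (If $m=0$, all functions are identified and the assertion is trivial.) -/

import Mathlib

open MeasureTheory Filter Topology
open scoped ENNReal NNReal

/-- A (symmetric) Dirichlet form on `L²(m)`: a densely defined, symmetric, nonnegative, closed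
bilinear form on which the unit contraction `u ↦ (0 ∨ u) ∧ 1` operates. -/
structure DirichletForm {X : Type*} [MeasurableSpace X] (m : Measure X) where
  /-- the domain `D(E)` -/
  domain : Submodule ℝ (Lp ℝ 2 m)
  /-- the bilinear form `E(u, v)` -/
  form : domain →ₗ[ℝ] domain →ₗ[ℝ] ℝ
  dense_domain : Dense (domain : Set (Lp ℝ 2 m))
  symm : ∀ u v : domain, form u v = form v u
  nonneg : ∀ u : domain, 0 ≤ form u u
  /-- `D(E)` is complete with respect to the norm `(E(u, u) + ‖u‖²)^(1/2)`. -/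
  closed : ∀ u : ℕ → domain,
    CauchySeq (fun n => (u n : Lp ℝ 2 m)) →
    (∀ ε : ℝ, 0 < ε → ∃ N : ℕ, ∀ n ≥ N, ∀ k ≥ N, form (u n - u k) (u n - u k) < ε) →
    ∃ v : domain, Tendsto (fun n => (u n : Lp ℝ 2 m)) atTop (𝓝 (v : Lp ℝ 2 m)) ∧
      Tendsto (fun n => form (u n - v) (u n - v)) atTop (𝓝 0)
  markov : ∀ u : domain, ∃ v : domain,
    ((v : Lp ℝ 2 m) : X → ℝ) =ᵐ[m] (fun x => min (max ((u : Lp ℝ 2 m) x) 0) 1) ∧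
      form v v ≤ form u u

/-- A strongly continuous semigroup (`C₀`-semigroup) of bounded operators on a normed space. -/
structure IsC0Semigroup {B : Type*} [NormedAddCommGroup B] [NormedSpace ℝ B]
    (T : ℝ≥0 → B →L[ℝ] B) : Prop where
  zero : T 0 = ContinuousLinearMap.id ℝ B
  add : ∀ s t : ℝ≥0, T (s + t) = (T s).comp (T t)
  cont : ∀ f : B, Continuous (fun t : ℝ≥0 => T t f)

/-- The generator `A` of the operator family `T`, as a relation: `SemigroupGenerator T f g` means
`f ∈ D(A)` and `A f = g`, where `A f = lim_{h → 0+} h⁻¹ (f - T_h f)` in norm. The sign is such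
that `T_t = e^{-tA}`. -/
def SemigroupGenerator {B : Type*} [NormedAddCommGroup B] [NormedSpace ℝ B]
    (T : ℝ≥0 → B →L[ℝ] B) (f g : B) : Prop :=
  Tendsto (fun h : ℝ≥0 => (h : ℝ)⁻¹ • (f - T h f)) (𝓝[>] 0) (𝓝 g)

/-- The operator `S` on `L^p(m)` agrees with the operator `T` on `L²(m)` on `L^p(m) ∩ L²(m)`. -/
def AgreeOnInter {X : Type*} [MeasurableSpace X] {m : Measure X} {p : ℝ≥0∞} [Fact (1 ≤ p)]
    (T : Lp ℝ 2 m →L[ℝ] Lp ℝ 2 m) (S : Lp ℝ p m →L[ℝ] Lp ℝ p m) : Prop :=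
  ∀ (u : Lp ℝ 2 m) (v : Lp ℝ p m), (u : X → ℝ) =ᵐ[m] v → (T u : X → ℝ) =ᵐ[m] S v

/-- Weak-*-continuity of an operator on `L^∞(m) = L¹(m)'`: it has a pre-adjoint on `L¹(m)`. -/
def IsWeakStarContinuous {X : Type*} [MeasurableSpace X] {m : Measure X}
    (S : Lp ℝ ∞ m →L[ℝ] Lp ℝ ∞ m) : Prop :=
  ∃ S' : Lp ℝ 1 m → Lp ℝ 1 m, ∀ (f : Lp ℝ ∞ m) (g : Lp ℝ 1 m),
    ∫ x, S f x * g x ∂m = ∫ x, f x * S' g x ∂m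

namespace DirichletForm

/-- The nonnegative self-adjoint operator `L` of the form, as a relation: `E.Generator f g` means
`f ∈ D(L)` and `L f = g`, that is, `f ∈ D(E)` and `E(f, v) = ⟨g, v⟩` for all `v ∈ D(E)`. -/
def Generator {X : Type*} [MeasurableSpace X] {m : Measure X} (E : DirichletForm m)
    (f g : Lp ℝ 2 m) : Prop :=
  ∃ hf : f ∈ E.domain, ∀ v : E.domain, E.form ⟨f, hf⟩ v = inner ℝ g (v : Lp ℝ 2 m)

/-- `T` is the semigroup `e^{-tL}`: the `C₀`-semigroup on `L²(m)` whose generator is `L`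
(with equality of domains). -/
def IsAssociatedSemigroup {X : Type*} [MeasurableSpace X] {m : Measure X} (E : DirichletForm m)
    (T : ℝ≥0 → Lp ℝ 2 m →L[ℝ] Lp ℝ 2 m) : Prop :=
  IsC0Semigroup T ∧ ∀ f g : Lp ℝ 2 m, SemigroupGenerator T f g ↔ E.Generator f g

open Classical in
/-- The semigroup `T_t = e^{-tL}` on `L²(m)`. By the Hille-Yosida theorem there is exactly one
`C₀`-semigroup with generator `L`, so the alternative `0` never occurs. -/
noncomputable def semigroup {X : Type*} [MeasurableSpace X] {m : Measure X}
    (E : DirichletForm m) : ℝ≥0 → Lp ℝ 2 m →L[ℝ] Lp ℝ 2 m :=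
  if h : ∃ T, E.IsAssociatedSemigroup T then h.choose else 0

open Classical in
/-- The extension `T^p_t` of the semigroup to `L^p(m)`, `1 ≤ p < ∞`: the unique bounded operator
on `L^p(m)` that agrees with `T_t` on `L^p(m) ∩ L²(m)`. It exists because `T_t` is Markovian, so
the alternative `0` never occurs. -/
noncomputable def lpSemigroup {X : Type*} [MeasurableSpace X] {m : Measure X}
    (E : DirichletForm m) (p : ℝ≥0∞) [Fact (1 ≤ p)] (t : ℝ≥0) : Lp ℝ p m →L[ℝ] Lp ℝ p m :=
  if h : ∃ S : Lp ℝ p m →L[ℝ] Lp ℝ p m, AgreeOnInter (E.semigroup t) S then h.choose else 0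

open Classical in
/-- The extension of the semigroup to `L^∞(m)`: the unique weak-*-continuous operator on `L^∞(m)`
that agrees with `T_t` on `L^∞(m) ∩ L²(m)`. It exists (it is the adjoint of the extension to
`L¹(m)`), so the alternative `0` never occurs when `m` is `σ`-finite. -/
noncomputable def linftySemigroup {X : Type*} [MeasurableSpace X] {m : Measure X}
    (E : DirichletForm m) (t : ℝ≥0) : Lp ℝ ∞ m →L[ℝ] Lp ℝ ∞ m :=
  if h : ∃ S : Lp ℝ ∞ m →L[ℝ] Lp ℝ ∞ m, AgreeOnInter (E.semigroup t) S ∧ IsWeakStarContinuous S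
  then h.choose else 0

/-- `E` is conservative: `T_t 1 = 1` for all `t`. -/
def IsConservative {X : Type*} [MeasurableSpace X] {m : Measure X} (E : DirichletForm m) : Prop :=
  ∀ t : ℝ≥0, E.linftySemigroup t ((memLp_top_const (1 : ℝ)).toLp (fun _ : X => (1 : ℝ))) =
    (memLp_top_const (1 : ℝ)).toLp (fun _ : X => (1 : ℝ))

/-- A measurable set `A` is invariant if `T_t (1_A f) = 1_A T_t f` for all `f ∈ L²(m)` and all
`t`. -/
def IsInvariantSet {X : Type*} [MeasurableSpace X] {m : Measure X} (E : DirichletForm m)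
    (A : Set X) : Prop :=
  MeasurableSet A ∧ ∀ (t : ℝ≥0) (f g : Lp ℝ 2 m), (g : X → ℝ) =ᵐ[m] A.indicator f →
    (E.semigroup t g : X → ℝ) =ᵐ[m] A.indicator (E.semigroup t f)

/-- `E` is irreducible: every invariant set is null or has null complement. -/
def IsIrreducible {X : Type*} [MeasurableSpace X] {m : Measure X} (E : DirichletForm m) : Prop :=
  ∀ A : Set X, E.IsInvariantSet A → m A = 0 ∨ m Aᶜ = 0

/-- `f ∈ L^p(m)` is `L_p`-harmonic: `f ∈ D(L_p)` and `L_p f = 0`, where `L_p` is the generator of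
the semigroup on `L^p(m)`. -/
def IsLpHarmonic {X : Type*} [MeasurableSpace X] {m : Measure X} (E : DirichletForm m)
    (p : ℝ≥0∞) [Fact (1 ≤ p)] (f : Lp ℝ p m) : Prop :=
  SemigroupGenerator (E.lpSemigroup p) f 0

/-- `0` is an eigenvalue of `L`. -/
def ZeroIsEigenvalue {X : Type*} [MeasurableSpace X] {m : Measure X} (E : DirichletForm m) :
    Prop :=
  ∃ u : Lp ℝ 2 m, u ≠ 0 ∧ E.Generator u 0

/-- `Φ` is the ground state: it is `0` if `0` is not an eigenvalue of `L`, and otherwise it is the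
positive constant eigenfunction to the eigenvalue `0` with `‖Φ‖₂ = 1`. -/
def IsGroundState {X : Type*} [MeasurableSpace X] {m : Measure X} (E : DirichletForm m)
    (Φ : Lp ℝ 2 m) : Prop :=
  (¬ E.ZeroIsEigenvalue ∧ Φ = 0) ∨
    (E.ZeroIsEigenvalue ∧ E.Generator Φ 0 ∧ ‖Φ‖ = 1 ∧
      ∃ c : ℝ, 0 < c ∧ (Φ : X → ℝ) =ᵐ[m] fun _ => c)

end DirichletForm

/-!
Harmonic functions of irreducible Dirichlet forms.

The operator `L` of a closed form is maximal accretive: its resolvents come from the Riesz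
representation theorem on `D(E)` (`DirichletForm.exists_form_add_inner_eq`), and the semigroup
`T_t = e^{-tL}` is the limit of the exponentials of the Yosida approximations
(`IsMaximalAccretive.exists_semigroup`). The resolvents are symmetric and, since the unit contraction
operates on the form, preserve `0 ≤ f ≤ 1`; both properties pass to `T_t`
(`DirichletForm.isSymmetricMarkov_semigroup`). Jensen's inequality `(T f)^p ≤ T (f^p)` and the bound
`∫ T g ≤ ∫ g`, dual to `T 1 ≤ 1`, show that `T_t` contracts the `L^p` norm, so that it extends to a
positive contraction of `L^p(m)` for `1 ≤ p < ∞` (`IsSymmetricMarkov.exists_agreeOnInter`).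

An `L_p`-harmonic function `f` satisfies `T_t f = f` for all `t` (`DirichletForm.fixed_of_generator`).
The `L^p` norm is strictly monotone on nonnegative functions, so a contraction has no subharmonic
functions `a ≥ 0` besides the harmonic ones: `a ≤ T a` forces `T a = a`. Hence `|f|` is harmonic,
and if `f ≥ 0` then so is `(f - c)⁺` for `c ≥ 0`, because `f ∧ c` is superharmonic
(`AgreeOnInter.sub_truncAbove_fixed`). The set where a nonnegative harmonic function is positive is
invariant (`AgreeOnInter.indicator_pos_commute`). By irreducibility every set `{f > c}` is null or
conull, which means that `f` is constant (`DirichletForm.IsIrreducible.ae_const`).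

A nonzero constant lies in `L^p(m)` only if `m(X) < ∞`, and if it is harmonic, then `1 ∈ L²(m)` is a
fixed vector. So `0` is an eigenvalue with the ground state `m(X)^(-1/2)`, and the form is
conservative because the extension to `L^∞(m)` exists (`IsSymmetricMarkov.exists_linfty`). The case
`p = 2` shows that eigenfunctions to the eigenvalue `0` are constant, which gives existence of the
ground state.
-/

/-! ### Accretive operators and the Yosida approximation -/

section Accretive

variable {H : Type*} [NormedAddCommGroup H] [InnerProductSpace ℝ H]

/-- `A` is the graph of a densely defined accretive operator on a real Hilbert space, and
`J lam = lam (lam + A)⁻¹` for `lam > 0`, so that in particular the operator is maximal. -/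
structure IsMaximalAccretive (A : H → H → Prop) (J : ℝ → H →L[ℝ] H) : Prop where
  sub : ∀ {f g f' g'}, A f g → A f' g' → A (f - f') (g - g')
  accretive : ∀ {f g}, A f g → 0 ≤ inner ℝ g f
  resolvent : ∀ {lam : ℝ}, 0 < lam → ∀ f, A (J lam f) (lam • (f - J lam f))
  dense : Dense {f | ∃ g, A f g}

namespace IsMaximalAccretive

variable {A : H → H → Prop} {J : ℝ → H →L[ℝ] H} (hA : IsMaximalAccretive A J)
include hA

/-- Pairing `A u = lam (f - u)` with `u = J lam f` gives `‖u‖² ≤ ⟨f, u⟩`. -/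
theorem norm_resolvent_le {lam : ℝ} (hl : 0 < lam) (f : H) : ‖J lam f‖ ≤ ‖f‖ := by
  have h := hA.accretive (hA.resolvent hl f)
  rw [inner_smul_left, inner_sub_left, real_inner_self_eq_norm_sq] at h
  have h2 : 0 ≤ inner ℝ f (J lam f) - ‖J lam f‖ ^ 2 :=
    nonneg_of_mul_nonneg_right h hl
  have h3 := real_inner_le_norm f (J lam f)
  by_contra! hc
  have h0 : 0 < ‖J lam f‖ := (norm_nonneg f).trans_lt hc
  nlinarith

/-- The resolvent commutes with the operator: `lam (1 - J lam) = A J lam = J lam A` on its domain. -/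
theorem resolvent_sub {lam : ℝ} (hl : 0 < lam) {f g : H} (h : A f g) :
    lam • (f - J lam f) = J lam g := by
  -- `f` solves `u + lam⁻¹ A u = f + lam⁻¹ g`; by accretivity it is the only solution.
  have hr := hA.resolvent hl (f + lam⁻¹ • g)
  have h1 := hA.accretive (hA.sub hr h)
  have h2 : lam • (f + lam⁻¹ • g - J lam (f + lam⁻¹ • g)) - g
      = - (lam • (J lam (f + lam⁻¹ • g) - f)) := by
    rw [smul_sub, smul_add, smul_inv_smul₀ hl.ne', smul_sub]; abel
  rw [h2, inner_neg_left, inner_smul_left, real_inner_self_eq_norm_sq] at h1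
  have h3 : ‖J lam (f + lam⁻¹ • g) - f‖ = 0 := by
    by_contra hc
    have : 0 < ‖J lam (f + lam⁻¹ • g) - f‖ := lt_of_le_of_ne (norm_nonneg _) (Ne.symm hc)
    have : 0 < lam * ‖J lam (f + lam⁻¹ • g) - f‖ ^ 2 := by positivity
    rw [RCLike.conj_to_real] at h1
    linarith
  rw [norm_eq_zero, sub_eq_zero, map_add, map_smul] at h3
  nth_rewrite 1 [← h3]
  rw [add_sub_cancel_left, smul_inv_smul₀ hl.ne']


theorem resolvent_comm {lam mu : ℝ} (hl : 0 < lam) (hm : 0 < mu) :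
    Commute (J lam) (J mu) := by
  have key : ∀ f, J lam (J mu f) = J mu (J lam f) := by
    intro f
    have h1 := hA.resolvent_sub hm (hA.resolvent hl f)
    have h2 := hA.resolvent_sub hl (hA.resolvent hm (J lam f))
    rw [h1, map_smul, map_smul] at h2
    have h3 := smul_right_injective H hl.ne' h2
    have h4 : J mu (J lam f) - J lam (J mu (J lam f))
      = J lam (J mu f) - J lam (J mu (J lam f)) := by
      exact h3.trans (by rw [map_sub, map_sub])
    exact (sub_left_injective h4).symm
  ext f
  exact key f

theorem tendsto_resolvent (f : H) :
    Tendsto (fun n : ℕ => J ((n : ℝ) + 1) f) atTop (𝓝 f) := by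
  have hpos : ∀ n : ℕ, 0 < (n : ℝ) + 1 := fun n => by positivity
  rw [Metric.tendsto_atTop]
  intro ε hε
  obtain ⟨f', hf', g, hg⟩ := Metric.dense_iff.1 hA.dense f (ε / 3) (by positivity)
  obtain ⟨N, hN⟩ := exists_nat_gt (‖g‖ / (ε / 3))
  refine ⟨N, fun n hn => ?_⟩
  have h1 : ‖f' - J ((n : ℝ) + 1) f'‖ < ε / 3 := by
    have h := hA.resolvent_sub (hpos n) hg
    have h2 : ‖f' - J ((n : ℝ) + 1) f'‖ * ((n : ℝ) + 1) ≤ ‖g‖ := by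
      calc _ = ‖((n : ℝ) + 1) • (f' - J ((n : ℝ) + 1) f')‖ := by
            rw [norm_smul, Real.norm_of_nonneg (hpos n).le, mul_comm]
        _ ≤ ‖g‖ := by rw [h]; exact hA.norm_resolvent_le (hpos n) g
    have h3 : ‖g‖ < (ε / 3) * ((n : ℝ) + 1) := by
      rw [div_lt_iff₀ (by positivity)] at hN
      have : (N : ℝ) ≤ n := by exact_mod_cast hn
      nlinarith
    exact lt_of_mul_lt_mul_right (h2.trans_lt h3) (hpos n).le
  have h2 := hA.norm_resolvent_le (hpos n) (f - f')
  rw [Metric.mem_ball, dist_eq_norm, norm_sub_rev] at hf'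
  have e : J ((n : ℝ) + 1) f - f
      = J ((n : ℝ) + 1) (f - f') - (f' - J ((n : ℝ) + 1) f') - (f - f') := by
    rw [map_sub]; abel
  rw [dist_eq_norm, e]
  have := norm_sub_le (J ((n : ℝ) + 1) (f - f') - (f' - J ((n : ℝ) + 1) f')) (f - f')
  have := norm_sub_le (J ((n : ℝ) + 1) (f - f')) (f' - J ((n : ℝ) + 1) f')
  linarith

end IsMaximalAccretive

/-- A combination with nonnegative weights of sum at most `1` stays in a convex set through `0`. -/
theorem Convex.sum_smul_mem {C : Set H} (hC : Convex ℝ C) (h0 : (0 : H) ∈ C) {s : Finset ℕ}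
    {w : ℕ → ℝ} {z : ℕ → H} (hw : ∀ i ∈ s, 0 ≤ w i) (hw1 : ∑ i ∈ s, w i ≤ 1)
    (hz : ∀ i ∈ s, z i ∈ C) : ∑ i ∈ s, w i • z i ∈ C := by
  rcases (Finset.sum_nonneg hw).eq_or_lt with h | h
  · rw [eq_comm, Finset.sum_eq_zero_iff_of_nonneg hw] at h
    rw [Finset.sum_eq_zero fun i hi => by rw [h i hi, zero_smul]]
    exact h0
  · have h1 := hC.centerMass_mem hw h hz
    have h2 := hC.smul_mem_of_zero_mem h0 h1 ⟨h.le, hw1⟩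
    rwa [Finset.centerMass, smul_inv_smul₀ h.ne'] at h2

variable [CompleteSpace H]

/-- A closed convex set containing `0` that is invariant under `J` is invariant under
`exp (t lam (J - 1)) = e^(- t lam) ∑ (t lam)^k / k! J^k`. -/
theorem exp_smul_sub_one_mem {C : Set H} (hC : Convex ℝ C) (hcl : IsClosed C) (h0 : (0 : H) ∈ C)
    {J : H →L[ℝ] H} (hJ : ∀ f ∈ C, J f ∈ C) {t lam : ℝ} (ht : 0 ≤ t) (hl : 0 ≤ lam)
    {f : H} (hf : f ∈ C) :
    NormedSpace.exp (t • (lam • (J - 1))) f ∈ C := by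
  set c := t * lam with hc
  have hc0 : 0 ≤ c := mul_nonneg ht hl
  have e1 : t • (lam • (J - 1)) = c • J + (-c) • (1 : H →L[ℝ] H) := by
    rw [smul_smul, smul_sub, neg_smul, sub_eq_add_neg]
  have hcomm : Commute (c • J) ((-c) • (1 : H →L[ℝ] H)) :=
    (Commute.one_right _).smul_right _
  have e2 : NormedSpace.exp ((-c) • (1 : H →L[ℝ] H)) = Real.exp (-c) • (1 : H →L[ℝ] H) := by
    have := NormedSpace.algebraMap_exp_comm (𝔸 := H →L[ℝ] H) (-c)
    rw [Algebra.algebraMap_eq_smul_one, Algebra.algebraMap_eq_smul_one] at this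
    rw [← this, Real.exp_eq_exp_ℝ]
  let : NormedAlgebra ℚ (H →L[ℝ] H) := NormedAlgebra.restrictScalars ℚ ℝ _
  rw [e1, NormedSpace.exp_add_of_commute hcomm, e2]
  have hs := (NormedSpace.exp_series_hasSum_exp' (𝕂 := ℝ) (c • J)).mapL
    ((ContinuousLinearMap.apply ℝ H) (Real.exp (-c) • f))
  have e3 : (NormedSpace.exp (c • J) * (Real.exp (-c) • (1 : H →L[ℝ] H))) f
      = (ContinuousLinearMap.apply ℝ H) (Real.exp (-c) • f) (NormedSpace.exp (c • J)) := by
    simp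
  rw [e3]
  refine hcl.mem_of_tendsto hs.tendsto_sum_nat (Eventually.of_forall fun N => ?_)
  have e4 : ∀ k : ℕ, (ContinuousLinearMap.apply ℝ H) (Real.exp (-c) • f)
      (((k.factorial : ℝ)⁻¹) • (c • J) ^ k)
      = (Real.exp (-c) * (c ^ k / k.factorial)) • (J ^ k) f := by
    intro k
    simp only [ContinuousLinearMap.apply_apply, smul_pow, smul_apply, map_smul,
      smul_smul]
    congr 1
    ring
  simp only [e4]
  refine hC.sum_smul_mem h0 (fun k _ => by positivity) ?_ ?_
  · rw [← Finset.mul_sum]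
    have := Real.sum_le_exp_of_nonneg hc0 N
    calc _ ≤ Real.exp (-c) * Real.exp c := by gcongr
      _ = 1 := by rw [← Real.exp_add]; simp
  · rintro k -
    induction k with
    | zero => simpa using hf
    | succ k ih => rw [pow_succ']; exact hJ _ ih

theorem norm_exp_smul_sub_one_le {J : H →L[ℝ] H} (hJ : ∀ f, ‖J f‖ ≤ ‖f‖) {t lam : ℝ} (ht : 0 ≤ t)
    (hl : 0 ≤ lam) (f : H) : ‖NormedSpace.exp (t • (lam • (J - 1))) f‖ ≤ ‖f‖ := by
  have := exp_smul_sub_one_mem (convex_closedBall (0 : H) ‖f‖) Metric.isClosed_closedBall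
    (by simp) (J := J) (fun g hg => by
      rw [mem_closedBall_zero_iff] at hg ⊢; exact (hJ g).trans hg) ht hl (f := f) (by simp)
  simpa using this

/-- `exp (t X) f - exp (t Y) f` is the integral of `exp (s X) exp ((t - s) Y) (X - Y) f`. -/
theorem norm_exp_sub_exp_le {X Y : H →L[ℝ] H} (hXY : Commute X Y)
    (hX : ∀ s : ℝ, 0 ≤ s → ∀ f, ‖NormedSpace.exp (s • X) f‖ ≤ ‖f‖)
    (hY : ∀ s : ℝ, 0 ≤ s → ∀ f, ‖NormedSpace.exp (s • Y) f‖ ≤ ‖f‖) {t : ℝ} (ht : 0 ≤ t) (f : H) :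
    ‖NormedSpace.exp (t • X) f - NormedSpace.exp (t • Y) f‖ ≤ t * ‖X f - Y f‖ := by
  have hd : ∀ s : ℝ, HasDerivAt
      (fun s : ℝ => (NormedSpace.exp (s • X) * NormedSpace.exp ((t - s) • Y)) f)
      ((NormedSpace.exp (s • X) * NormedSpace.exp ((t - s) • Y)) (X f - Y f)) s := by
    intro s
    have h1 := hasDerivAt_exp_smul_const (𝕂 := ℝ) X s
    have h2 : HasDerivAt (fun s : ℝ => NormedSpace.exp ((t - s) • Y))
        (-(NormedSpace.exp ((t - s) • Y) * Y)) s := by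
      have := (hasDerivAt_exp_smul_const (𝕂 := ℝ) Y (t - s)).scomp s
        ((hasDerivAt_id s).const_sub t)
      exact this.congr_deriv (by simp)
    have h3 := ((ContinuousLinearMap.apply ℝ H) f).hasFDerivAt.comp_hasDerivAt s (h1.mul h2)
    refine h3.congr_deriv ?_
    have hc : X * NormedSpace.exp ((t - s) • Y) = NormedSpace.exp ((t - s) • Y) * X :=
      ((hXY.smul_right (t - s)).exp_right).eq
    rw [mul_assoc, hc]
    simp [sub_eq_add_neg]
  have hb := norm_image_sub_le_of_norm_deriv_le_segment' (a := 0) (b := t)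
    (C := ‖X f - Y f‖) (fun s _ => (hd s).hasDerivWithinAt) (fun s hs => by
      exact (hX s hs.1 _).trans (hY (t - s) (by linarith [hs.2]) _)) t ⟨ht, le_rfl⟩
  simpa [mul_comm] using hb

/-- The derivative of `exp (s X) f - s v` is `exp (s X) (X f - v) + (exp (s X) v - v)`, and the second
term is small because `v` is close to a vector `w` with `X w` under control. -/
theorem norm_exp_sub_sub_smul_le {X : H →L[ℝ] H}
    (hX : ∀ s : ℝ, 0 ≤ s → ∀ f, ‖NormedSpace.exp (s • X) f‖ ≤ ‖f‖) {t : ℝ} (ht : 0 ≤ t)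
    (f v w : H) :
    ‖NormedSpace.exp (t • X) f - f - t • v‖ ≤ t * (‖X f - v‖ + 2 * ‖v - w‖ + t * ‖X w‖) := by
  have hd : ∀ s : ℝ, HasDerivAt (fun s : ℝ => NormedSpace.exp (s • X) f - s • v)
      (NormedSpace.exp (s • X) (X f) - v) s := by
    intro s
    have h1 := hasDerivAt_exp_smul_const (𝕂 := ℝ) X s
    have h3 := ((ContinuousLinearMap.apply ℝ H) f).hasFDerivAt.comp_hasDerivAt s h1
    have := h3.sub ((hasDerivAt_id s).smul_const v)
    exact this.congr_deriv (by simp)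
  have hb := norm_image_sub_le_of_norm_deriv_le_segment' (a := 0) (b := t)
    (C := ‖X f - v‖ + 2 * ‖v - w‖ + t * ‖X w‖) (fun s _ => (hd s).hasDerivWithinAt)
    (fun s hs => by
      have h1 := hX s hs.1 (X f - v)
      have h2 := hX s hs.1 (v - w)
      have h3 := norm_exp_sub_exp_le (Commute.zero_right X) hX (Y := 0)
        (fun s _ f => by simp) hs.1 w
      have h4 : s * ‖X w‖ ≤ t * ‖X w‖ := by gcongr; exact hs.2.le
      simp only [smul_zero, NormedSpace.exp_zero, one_apply_eq_self,
        zero_apply, sub_zero] at h3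
      have e : NormedSpace.exp (s • X) (X f) - v = NormedSpace.exp (s • X) (X f - v)
        + (NormedSpace.exp (s • X) (v - w) + (NormedSpace.exp (s • X) w - w) - (v - w)) := by
        simp only [map_sub]; abel
      rw [e]
      have h5 := norm_add_le (NormedSpace.exp (s • X) (X f - v))
        (NormedSpace.exp (s • X) (v - w) + (NormedSpace.exp (s • X) w - w) - (v - w))
      have h6 := norm_sub_le (NormedSpace.exp (s • X) (v - w) + (NormedSpace.exp (s • X) w - w))
        (v - w)
      have h7 := norm_add_le (NormedSpace.exp (s • X) (v - w)) (NormedSpace.exp (s • X) w - w)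
      linarith) t ⟨ht, le_rfl⟩
  have e : NormedSpace.exp (t • X) f - f - t • v = NormedSpace.exp (t • X) f - t • v - f := by abel
  rw [e]
  simpa [mul_comm] using hb

end Accretive

/-! ### Generation of contraction semigroups -/

section Semigroup

variable {H : Type*} [NormedAddCommGroup H] [InnerProductSpace ℝ H]

theorem SemigroupGenerator.sub {T : ℝ≥0 → H →L[ℝ] H} {f g f' g' : H}
    (h : SemigroupGenerator T f g) (h' : SemigroupGenerator T f' g') :
    SemigroupGenerator T (f - f') (g - g') := by
  refine (Tendsto.sub h h').congr fun t => ?_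
  rw [map_sub, ← smul_sub]
  congr 1
  abel

/-- The generator commutes with the semigroup. -/
theorem SemigroupGenerator.map {T : ℝ≥0 → H →L[ℝ] H} (hT : IsC0Semigroup T) {f g : H}
    (h : SemigroupGenerator T f g) (t : ℝ≥0) : SemigroupGenerator T (T t f) (T t g) := by
  refine (((T t).continuous.tendsto g).comp h).congr fun s => ?_
  have : T t (T s f) = T s (T t f) := by
    rw [← ContinuousLinearMap.comp_apply, ← hT.add, add_comm, hT.add,
      ContinuousLinearMap.comp_apply]
  simp [this]

/-- Orbits of vectors in the domain of the generator are differentiable from the right. -/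
theorem SemigroupGenerator.hasDerivWithinAt {T : ℝ≥0 → H →L[ℝ] H} (hT : IsC0Semigroup T) {f g : H}
    (h : SemigroupGenerator T f g) {t : ℝ} (ht : 0 ≤ t) :
    HasDerivWithinAt (fun s : ℝ => T s.toNNReal f) (-T t.toNNReal g) (Set.Ici t) t := by
  rw [← hasDerivWithinAt_Ioi_iff_Ici, hasDerivWithinAt_iff_tendsto_slope' Set.self_notMem_Ioi]
  have h1 : Tendsto (fun s : ℝ => (s - t).toNNReal) (𝓝[>] t) (𝓝[>] 0) := by
    refine tendsto_nhdsWithin_iff.2 ⟨?_, ?_⟩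
    · have : Tendsto (fun s : ℝ => (s - t).toNNReal) (𝓝 t) (𝓝 (t - t).toNNReal) :=
        (continuous_real_toNNReal.comp (continuous_id.sub continuous_const)).tendsto t
      rw [sub_self, Real.toNNReal_zero] at this
      exact this.mono_left nhdsWithin_le_nhds
    · filter_upwards [self_mem_nhdsWithin] with s hs
      simpa using hs
  have h2 := (((-T t.toNNReal).continuous.tendsto g).comp (Tendsto.comp h h1))
  refine h2.congr' ?_
  filter_upwards [self_mem_nhdsWithin] with s hs
  have hs' : t < s := hs
  have e : s.toNNReal = t.toNNReal + (s - t).toNNReal := by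
    rw [← Real.toNNReal_add ht (by linarith)]; congr 1; ring
  simp only [Function.comp_apply, slope_def_module, neg_apply, map_smul, map_sub]
  rw [e, hT.add, ContinuousLinearMap.comp_apply, Real.coe_toNNReal _ (by linarith), sub_neg_eq_add,
    neg_add_eq_sub]

namespace IsMaximalAccretive

variable {A : H → H → Prop} {J : ℝ → H →L[ℝ] H} (hA : IsMaximalAccretive A J)
include hA

/-- A `C₀`-semigroup is determined by its generator: for two semigroups `S`, `T` with the
accretive generator `A`, the derivative `-2 ⟨A (S_t f - T_t f), S_t f - T_t f⟩` of
`‖S_t f - T_t f‖²` is nonpositive. -/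
theorem semigroup_unique {S T : ℝ≥0 → H →L[ℝ] H} (hS : IsC0Semigroup S) (hT : IsC0Semigroup T)
    (hSA : ∀ f g, SemigroupGenerator S f g ↔ A f g)
    (hTA : ∀ f g, SemigroupGenerator T f g ↔ A f g) : S = T := by
  funext t
  have key : ∀ f ∈ {f | ∃ g, A f g}, S t f = T t f := by
    rintro f ⟨g, hfg⟩
    set w : ℝ → H := fun s => S s.toNNReal f - T s.toNNReal f
    have hw : Continuous w := ((hS.cont f).comp continuous_real_toNNReal).sub
      ((hT.cont f).comp continuous_real_toNNReal)
    have hd : ∀ s : ℝ, 0 ≤ s → HasDerivWithinAt w (-S s.toNNReal g - -T s.toNNReal g)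
        (Set.Ici s) s := fun s hs =>
      (((hSA f g).2 hfg).hasDerivWithinAt hS hs).sub (((hTA f g).2 hfg).hasDerivWithinAt hT hs)
    have hle := image_le_of_deriv_right_le_deriv_boundary (a := 0) (b := (t : ℝ))
      (f := fun s => ‖w s‖ ^ 2) (B := fun _ => 0) (B' := fun _ => 0)
      (hw.norm.pow 2).continuousOn (fun s hs => (hd s hs.1).norm_sq)
      (by simp [w, hS.zero, hT.zero]) continuousOn_const
      (fun s _ => hasDerivWithinAt_const _ _ _) (fun s hs => by
        have h1 := hA.accretive (hA.sub
          ((hSA _ _).1 (((hSA f g).2 hfg).map hS s.toNNReal))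
          ((hTA _ _).1 (((hTA f g).2 hfg).map hT s.toNNReal)))
        have h2 : -S s.toNNReal g - -T s.toNNReal g = -(S s.toNNReal g - T s.toNNReal g) := by abel
        rw [h2, inner_neg_right, real_inner_comm]
        linarith) (x := t) ⟨t.2, le_rfl⟩
    have h0 : ‖w t‖ = 0 := by
      have := sq_nonneg ‖w t‖
      exact pow_eq_zero_iff two_ne_zero |>.1 (le_antisymm hle this)
    rw [norm_eq_zero] at h0
    simpa [w, sub_eq_zero] using h0
  exact ContinuousLinearMap.ext fun f => congrFun
    (Continuous.ext_on hA.dense (S t).continuous (T t).continuous key) f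

/-- A maximal accretive operator has no proper extension that generates a contraction semigroup. -/
theorem generator_of_le {T : ℝ≥0 → H →L[ℝ] H}
    (hT : ∀ t f, ‖T t f‖ ≤ ‖f‖) (h : ∀ f g, A f g → SemigroupGenerator T f g) {f g : H}
    (hfg : SemigroupGenerator T f g) : A f g := by
  have h1 := hA.resolvent one_pos (f + g)
  rw [one_smul] at h1
  set u := J 1 (f + g)
  have h2 := hfg.sub (h _ _ h1)
  have h3 : 0 ≤ inner ℝ (g - (f + g - u)) (f - u) := by
    refine ge_of_tendsto (Tendsto.inner h2 tendsto_const_nhds) (Eventually.of_forall fun t => ?_)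
    rw [inner_smul_left, RCLike.conj_to_real, inner_sub_left, real_inner_self_eq_norm_sq]
    have := real_inner_le_norm (T t (f - u)) (f - u)
    have := mul_le_mul_of_nonneg_right (hT t (f - u)) (norm_nonneg (f - u))
    exact mul_nonneg (by positivity) (by nlinarith)
  have h4 : f = u := by
    have e : g - (f + g - u) = -(f - u) := by abel
    rw [e, inner_neg_left, real_inner_self_eq_norm_sq] at h3
    have h5 : ‖f - u‖ = 0 := by
      have := sq_nonneg ‖f - u‖
      exact pow_eq_zero_iff two_ne_zero |>.1 (by linarith)
    rwa [norm_eq_zero, sub_eq_zero] at h5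
  rw [← h4, add_sub_cancel_left] at h1
  exact h1

end IsMaximalAccretive

/-- The bounded operators `(n + 1) (J (n + 1) - 1)` approximating `-A`. -/
noncomputable def yosidaApprox (J : ℝ → H →L[ℝ] H) (n : ℕ) : H →L[ℝ] H :=
  ((n : ℝ) + 1) • (J ((n : ℝ) + 1) - 1)

namespace IsMaximalAccretive

variable [CompleteSpace H] {A : H → H → Prop} {J : ℝ → H →L[ℝ] H} (hA : IsMaximalAccretive A J)
include hA

theorem norm_exp_yosidaApprox_le (n : ℕ) (t : ℝ) (ht : 0 ≤ t) (f : H) :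
    ‖NormedSpace.exp (t • yosidaApprox J n) f‖ ≤ ‖f‖ :=
  norm_exp_smul_sub_one_le (hA.norm_resolvent_le (by positivity)) ht (by positivity) f

omit [CompleteSpace H] in
/-- On the domain of `A` the Yosida approximation of `-A` is `-J (n + 1) A`. -/
theorem yosidaApprox_apply {f g : H} (h : A f g) (n : ℕ) :
    yosidaApprox J n f = -J ((n : ℝ) + 1) g := by
  rw [← hA.resolvent_sub (by positivity) h, yosidaApprox]
  simp [← smul_neg]

omit [CompleteSpace H] in
theorem norm_yosidaApprox_apply_le {f g : H} (h : A f g) (n : ℕ) :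
    ‖yosidaApprox J n f‖ ≤ ‖g‖ := by
  rw [hA.yosidaApprox_apply h, norm_neg]
  exact hA.norm_resolvent_le (by positivity) g

omit [CompleteSpace H] in
theorem commute_yosidaApprox (n k : ℕ) : Commute (yosidaApprox J n) (yosidaApprox J k) := by
  refine Commute.smul_left (Commute.smul_right ?_ _) _
  have := hA.resolvent_comm (lam := (n : ℝ) + 1) (mu := (k : ℝ) + 1) (by positivity) (by positivity)
  exact (this.sub_right (Commute.one_right _)).sub_left (Commute.one_left _)

theorem cauchySeq_exp_yosidaApprox (t : ℝ) (ht : 0 ≤ t) (f : H) :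
    CauchySeq fun n => NormedSpace.exp (t • yosidaApprox J n) f := by
  rw [Metric.cauchySeq_iff]
  intro ε hε
  obtain ⟨f', hf', g, hg⟩ := Metric.dense_iff.1 hA.dense f (ε / 3) (by positivity)
  rw [Metric.mem_ball, dist_eq_norm, norm_sub_rev] at hf'
  have hc := (hA.tendsto_resolvent g).cauchySeq
  obtain ⟨N, hN⟩ := Metric.cauchySeq_iff.1 hc (ε / 3 / (t + 1)) (by positivity)
  refine ⟨N, fun n hn k hk => ?_⟩
  have h1 := norm_exp_sub_exp_le (hA.commute_yosidaApprox n k)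
    (hA.norm_exp_yosidaApprox_le n) (hA.norm_exp_yosidaApprox_le k) ht f'
  have h2 := hN n hn k hk
  rw [hA.yosidaApprox_apply hg, hA.yosidaApprox_apply hg, ← neg_sub', norm_neg] at h1
  rw [dist_eq_norm] at h2 ⊢
  have h3 := hA.norm_exp_yosidaApprox_le n t ht (f - f')
  have h4 := hA.norm_exp_yosidaApprox_le k t ht (f - f')
  have h5 : t * ‖J ((n : ℝ) + 1) g - J ((k : ℝ) + 1) g‖ ≤ ε / 3 := by
    rw [lt_div_iff₀ (by positivity)] at h2
    nlinarith [norm_nonneg (J ((n : ℝ) + 1) g - J ((k : ℝ) + 1) g)]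
  have e : NormedSpace.exp (t • yosidaApprox J n) f - NormedSpace.exp (t • yosidaApprox J k) f
      = NormedSpace.exp (t • yosidaApprox J n) (f - f')
        + (NormedSpace.exp (t • yosidaApprox J n) f' - NormedSpace.exp (t • yosidaApprox J k) f')
        - NormedSpace.exp (t • yosidaApprox J k) (f - f') := by
    simp only [map_sub]; abel
  rw [e]
  have := norm_sub_le (NormedSpace.exp (t • yosidaApprox J n) (f - f')
        + (NormedSpace.exp (t • yosidaApprox J n) f' - NormedSpace.exp (t • yosidaApprox J k) f'))
        (NormedSpace.exp (t • yosidaApprox J k) (f - f'))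
  have := norm_add_le (NormedSpace.exp (t • yosidaApprox J n) (f - f'))
    (NormedSpace.exp (t • yosidaApprox J n) f' - NormedSpace.exp (t • yosidaApprox J k) f')
  linarith

/-- **Hille-Yosida theorem**: a maximal accretive operator generates a contraction semigroup, the
limit of the exponentials of its Yosida approximations. -/
theorem exists_semigroup : ∃ T : ℝ≥0 → H →L[ℝ] H, IsC0Semigroup T ∧
    (∀ f g, SemigroupGenerator T f g ↔ A f g) ∧
    ∀ (t : ℝ≥0) (f : H), Tendsto (fun n => NormedSpace.exp ((t : ℝ) • yosidaApprox J n) f) atTop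
      (𝓝 (T t f)) := by
  choose F hF using fun (t : ℝ≥0) (f : H) =>
    cauchySeq_tendsto_of_complete (hA.cauchySeq_exp_yosidaApprox t t.2 f)
  let T : ℝ≥0 → H →L[ℝ] H := fun t => continuousLinearMapOfTendsto
    (fun n => NormedSpace.exp ((t : ℝ) • yosidaApprox J n)) (f := F t) (tendsto_pi_nhds.2 (hF t))
  have hT : ∀ (t : ℝ≥0) (f : H), Tendsto
      (fun n => NormedSpace.exp ((t : ℝ) • yosidaApprox J n) f) atTop (𝓝 (T t f)) := hF
  have hTc : ∀ t f, ‖T t f‖ ≤ ‖f‖ := fun t f =>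
    le_of_tendsto (hT t f).norm (Eventually.of_forall fun n =>
      hA.norm_exp_yosidaApprox_le n t t.2 f)
  have h0 : T 0 = ContinuousLinearMap.id ℝ H := by
    ext f
    refine tendsto_nhds_unique (hT 0 f) ?_
    simp
  have hadd : ∀ s t : ℝ≥0, T (s + t) = (T s).comp (T t) := by
    intro s t
    ext f
    refine tendsto_nhds_unique (hT (s + t) f) ?_
    let : NormedAlgebra ℚ (H →L[ℝ] H) := NormedAlgebra.restrictScalars ℚ ℝ _
    have e : ∀ n, NormedSpace.exp (((s + t : ℝ≥0) : ℝ) • yosidaApprox J n) f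
        = NormedSpace.exp ((s : ℝ) • yosidaApprox J n) (T t f)
          + NormedSpace.exp ((s : ℝ) • yosidaApprox J n)
            (NormedSpace.exp ((t : ℝ) • yosidaApprox J n) f - T t f) := by
      intro n
      rw [NNReal.coe_add, add_smul, NormedSpace.exp_add_of_commute
        (((Commute.refl (yosidaApprox J n)).smul_left _).smul_right _)]
      simp
    simp only [e]
    have h1 : Tendsto (fun n => NormedSpace.exp ((s : ℝ) • yosidaApprox J n)
        (NormedSpace.exp ((t : ℝ) • yosidaApprox J n) f - T t f)) atTop (𝓝 0) := by
      refine squeeze_zero_norm (fun n => hA.norm_exp_yosidaApprox_le n s s.2 _) ?_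
      have := ((hT t f).sub_const (T t f)).norm
      simpa using this
    simpa using (hT s (T t f)).add h1
  -- For `f = f'` this says that orbits of vectors in the domain are Lipschitz at `0`.
  have hlip : ∀ (h : ℝ≥0) {f f' g' : H}, A f' g' → ‖T h f - f‖ ≤ 2 * ‖f - f'‖ + h * ‖g'‖ := by
    intro h f f' g' hf'
    have h1 : ‖T h f' - f'‖ ≤ h * ‖g'‖ := by
      refine le_of_tendsto ((hT h f').sub_const f').norm (Eventually.of_forall fun n => ?_)
      have h3 := norm_exp_sub_exp_le (Commute.zero_right _) (hA.norm_exp_yosidaApprox_le n) (Y := 0)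
        (fun s _ f => by simp) h.2 f'
      simp only [smul_zero, NormedSpace.exp_zero, one_apply_eq_self, zero_apply, sub_zero] at h3
      exact h3.trans (mul_le_mul_of_nonneg_left (hA.norm_yosidaApprox_apply_le hf' n) h.2)
    have e : T h f - f = T h (f - f') + (T h f' - f') - (f - f') := by rw [map_sub]; abel
    rw [e]
    have := norm_sub_le (T h (f - f') + (T h f' - f')) (f - f')
    have := norm_add_le (T h (f - f')) (T h f' - f')
    have := hTc h (f - f')
    linarith
  have hdist : ∀ (s t : ℝ≥0) (f : H), ‖T s f - T t f‖ ≤ ‖T (nndist s t) f - f‖ := by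
    have aux : ∀ (s t : ℝ≥0) (f : H), t ≤ s → ‖T s f - T t f‖ ≤ ‖T (nndist s t) f - f‖ := by
      intro s t f hts
      obtain ⟨h, rfl⟩ := exists_add_of_le hts
      have e : nndist (t + h) t = h := by
        rw [NNReal.nndist_eq, add_tsub_cancel_left, tsub_eq_zero_of_le le_self_add,
          max_eq_left zero_le]
      rw [e, hadd, ContinuousLinearMap.comp_apply, ← map_sub]
      exact hTc _ _
    intro s t f
    rcases le_total t s with h | h
    · exact aux s t f h
    · rw [norm_sub_rev, nndist_comm]; exact aux t s f h
  have hgen : ∀ f g, A f g → SemigroupGenerator T f g := by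
    intro f g hfg
    -- `A w w'` only serves to approximate `g`, which need not lie in the domain itself.
    have hest : ∀ (h : ℝ≥0) {w w' : H}, A w w' →
        ‖T h f - f - (h : ℝ) • (-g)‖ ≤ h * (2 * ‖g - w‖ + h * ‖w'‖) := by
      intro h w w' hw
      have h1 : Tendsto (fun n => (h : ℝ) * (‖yosidaApprox J n f - -g‖ + 2 * ‖g - w‖ + h * ‖w'‖))
          atTop (𝓝 (h * (0 + 2 * ‖g - w‖ + h * ‖w'‖))) := by
        refine Tendsto.const_mul _ ((Tendsto.add_const _ ?_).add_const _)
        simp only [hA.yosidaApprox_apply hfg]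
        have := ((hA.tendsto_resolvent g).neg.sub_const (-g)).norm
        simpa using this
      rw [zero_add] at h1
      refine le_of_tendsto_of_tendsto (((hT h f).sub_const f).sub_const _).norm h1
        (Eventually.of_forall fun n => ?_)
      refine (norm_exp_sub_sub_smul_le (hA.norm_exp_yosidaApprox_le n) h.coe_nonneg f (-g) (-w)).trans ?_
      have h2 := hA.norm_yosidaApprox_apply_le hw n
      rw [map_neg, norm_neg, ← neg_sub', norm_neg]
      have := h.coe_nonneg
      beta_reduce
      gcongr
    rw [SemigroupGenerator, Metric.tendsto_nhdsWithin_nhds]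
    intro ε hε
    obtain ⟨w, hw, w', hww'⟩ := Metric.dense_iff.1 hA.dense g (ε / 4) (by positivity)
    rw [Metric.mem_ball, dist_eq_norm, norm_sub_rev] at hw
    refine ⟨ε / 2 / (‖w'‖ + 1), by positivity, fun {h} hh hd => ?_⟩
    have hh' : (0 : ℝ) < h := hh
    rw [lt_div_iff₀ (by positivity), NNReal.dist_eq, NNReal.coe_zero, sub_zero, abs_of_pos hh'] at hd
    have h1 := hest h hww'
    have e : (h : ℝ)⁻¹ • (f - T h f) - g = -((h : ℝ)⁻¹ • (T h f - f - (h : ℝ) • (-g))) := by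
      rw [smul_sub _ _ ((h : ℝ) • (-g)), inv_smul_smul₀ hh'.ne', neg_sub', ← smul_neg, neg_sub,
        neg_neg]
    rw [dist_eq_norm, e, norm_neg, norm_smul, norm_inv, Real.norm_of_nonneg hh'.le,
      inv_mul_lt_iff₀ hh']
    refine h1.trans_lt ?_
    gcongr
    nlinarith [norm_nonneg w']
  refine ⟨T, ⟨h0, hadd, fun f => ?_⟩, fun f g => ⟨hA.generator_of_le hTc hgen, hgen f g⟩, hT⟩
  rw [Metric.continuous_iff]
  intro t ε hε
  obtain ⟨f', hf', g', hg'⟩ := Metric.dense_iff.1 hA.dense f (ε / 4) (by positivity)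
  rw [Metric.mem_ball, dist_eq_norm, norm_sub_rev] at hf'
  refine ⟨ε / 2 / (‖g'‖ + 1), by positivity, fun s hs => ?_⟩
  rw [lt_div_iff₀ (by positivity)] at hs
  rw [dist_eq_norm]
  have h1 := hdist s t f
  have h2 := hlip (nndist s t) (f := f) hg'
  rw [coe_nndist] at h2
  nlinarith [norm_nonneg g', dist_nonneg (x := s) (y := t)]

/-- A closed convex set containing `0` and invariant under the resolvents is invariant under the
semigroup. -/
theorem semigroup_mem {T : ℝ≥0 → H →L[ℝ] H} (hT : IsC0Semigroup T)
    (hTA : ∀ f g, SemigroupGenerator T f g ↔ A f g) {C : Set H} (hC : Convex ℝ C)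
    (hcl : IsClosed C) (h0 : (0 : H) ∈ C) (hJ : ∀ lam : ℝ, 0 < lam → ∀ f ∈ C, J lam f ∈ C)
    (t : ℝ≥0) {f : H} (hf : f ∈ C) : T t f ∈ C := by
  obtain ⟨S, hS, hSA, hlim⟩ := hA.exists_semigroup
  rw [hA.semigroup_unique hT hS hTA hSA]
  exact hcl.mem_of_tendsto (hlim t f) (Eventually.of_forall fun n =>
    exp_smul_sub_one_mem hC hcl h0 (hJ _ (by positivity)) t.2 (by positivity) hf)

/-- Symmetry of the resolvents passes to the exponentials of the Yosida approximations and to their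
limit. -/
theorem semigroup_symm {T : ℝ≥0 → H →L[ℝ] H} (hT : IsC0Semigroup T)
    (hTA : ∀ f g, SemigroupGenerator T f g ↔ A f g)
    (hJ : ∀ lam : ℝ, 0 < lam → ∀ f g, inner ℝ (J lam f) g = inner ℝ f (J lam g))
    (t : ℝ≥0) (f g : H) : inner ℝ (T t f) g = inner ℝ f (T t g) := by
  obtain ⟨S, hS, hSA, hlim⟩ := hA.exists_semigroup
  rw [hA.semigroup_unique hT hS hTA hSA]
  have hX : ∀ n, IsSelfAdjoint (NormedSpace.exp ((t : ℝ) • yosidaApprox J n)) := by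
    intro n
    have h1 : IsSelfAdjoint (J ((n : ℝ) + 1)) := by
      rw [ContinuousLinearMap.isSelfAdjoint_iff_isSymmetric]
      exact fun f g => hJ _ (by positivity) f g
    have h2 : IsSelfAdjoint (J ((n : ℝ) + 1) - 1) := h1.sub (IsSelfAdjoint.one _)
    exact ((IsSelfAdjoint.all (t : ℝ)).smul ((IsSelfAdjoint.all ((n : ℝ) + 1)).smul h2)).exp
  refine tendsto_nhds_unique ((hlim t f).inner tendsto_const_nhds)
    ((tendsto_const_nhds.inner (hlim t g)).congr fun n => ?_)
  exact ((ContinuousLinearMap.isSelfAdjoint_iff_isSymmetric.1 (hX n)) f g).symm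

end IsMaximalAccretive
end Semigroup

/-! ### The semigroup of a Dirichlet form -/

section Forms

variable {X : Type*} [MeasurableSpace X] {m : Measure X}

/-- The functions `f ∈ L²(m)` with `0 ≤ f ≤ 1` almost everywhere. -/
def unitInterval2 (m : Measure X) : Set (Lp ℝ 2 m) :=
  {f | ∀ᵐ x ∂m, 0 ≤ f x ∧ f x ≤ 1}

theorem zero_mem_unitInterval2 : (0 : Lp ℝ 2 m) ∈ unitInterval2 m := by
  filter_upwards [Lp.coeFn_zero ℝ 2 m] with x hx
  rw [hx]; simp

theorem convex_unitInterval2 : Convex ℝ (unitInterval2 m) := by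
  intro f hf g hg a b ha hb hab
  filter_upwards [hf, hg, Lp.coeFn_add (a • f) (b • g), Lp.coeFn_smul a f, Lp.coeFn_smul b g]
    with x h1 h2 h3 h4 h5
  rw [h3, Pi.add_apply, h4, h5, Pi.smul_apply, Pi.smul_apply, smul_eq_mul, smul_eq_mul]
  constructor <;> nlinarith

/-- Almost everywhere membership of the values in a closed set passes to limits in `L^p`. -/
theorem ae_mem_of_tendsto_Lp {p : ℝ≥0∞} [Fact (1 ≤ p)] {S : Set ℝ} (hS : IsClosed S)
    {f : ℕ → Lp ℝ p m} {g : Lp ℝ p m} (hfg : Tendsto f atTop (𝓝 g))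
    (hf : ∀ n, ∀ᵐ x ∂m, f n x ∈ S) : ∀ᵐ x ∂m, g x ∈ S := by
  obtain ⟨φ, -, hφ⟩ := (tendstoInMeasure_of_tendsto_Lp hfg).exists_seq_tendsto_ae
  filter_upwards [hφ, ae_all_iff.2 hf] with x h1 h2
  exact hS.mem_of_tendsto h1 (Eventually.of_forall fun n => h2 _)

theorem isClosed_unitInterval2 : IsClosed (unitInterval2 m) := by
  refine IsSeqClosed.isClosed fun f g hf hfg => ?_
  exact ae_mem_of_tendsto_Lp isClosed_Icc hfg hf

/-- A bounded symmetric operator on `L²(m)` that is Markovian: it preserves `0 ≤ f ≤ 1`. Positivity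
and `T c ≤ c` for constants, which need not be in `L²(m)`, are encoded in this one condition. -/
structure IsSymmetricMarkov (T : Lp ℝ 2 m →L[ℝ] Lp ℝ 2 m) : Prop where
  symm : ∀ f g, inner ℝ (T f) g = inner ℝ f (T g)
  markov : ∀ f ∈ unitInterval2 m, T f ∈ unitInterval2 m

/-- **Riesz representation** for a positive definite symmetric bilinear form that is complete. -/
theorem exists_bilin_eq {V : Type*} [AddCommGroup V] [Module ℝ V] (B : V →ₗ[ℝ] V →ₗ[ℝ] ℝ)
    (hsymm : ∀ u v, B u v = B v u) (hnonneg : ∀ u, 0 ≤ B u u) (hdef : ∀ u, B u u = 0 → u = 0)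
    (hcomplete : ∀ u : ℕ → V,
      (∀ ε : ℝ, 0 < ε → ∃ N : ℕ, ∀ n ≥ N, ∀ k ≥ N, B (u n - u k) (u n - u k) < ε) →
      ∃ v, Tendsto (fun n => B (u n - v) (u n - v)) atTop (𝓝 0))
    (φ : V →ₗ[ℝ] ℝ) {C : ℝ} (hφ : ∀ v, φ v ^ 2 ≤ C ^ 2 * B v v) : ∃ u, ∀ v, B u v = φ v := by
  let core : InnerProductSpace.Core ℝ V :=
    { inner := fun u v => B u v
      conj_inner_symm := fun u v => hsymm v u
      re_inner_nonneg := fun u => hnonneg u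
      add_left := fun u v w => by simp
      smul_left := fun u v r => by simp
      definite := hdef }
  let : NormedAddCommGroup V := core.toNormedAddCommGroup
  let : InnerProductSpace ℝ V := InnerProductSpace.ofCore core.toCore
  have hnorm : ∀ u : V, B u u = ‖u‖ ^ 2 := fun u => real_inner_self_eq_norm_sq u
  have : CompleteSpace V := by
    refine Metric.complete_of_cauchySeq_tendsto fun u hu => ?_
    rw [Metric.cauchySeq_iff] at hu
    obtain ⟨v, hv⟩ := hcomplete u fun ε hε => by
      obtain ⟨N, hN⟩ := hu (Real.sqrt ε) (by positivity)
      refine ⟨N, fun n hn k hk => ?_⟩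
      have h1 := hN n hn k hk
      rw [dist_eq_norm] at h1
      rw [hnorm, ← Real.sq_sqrt hε.le]
      exact pow_lt_pow_left₀ h1 (norm_nonneg _) two_ne_zero
    refine ⟨v, ?_⟩
    rw [tendsto_iff_norm_sub_tendsto_zero]
    simp only [hnorm] at hv
    simpa using hv.sqrt
  let φc : V →L[ℝ] ℝ := φ.mkContinuous |C| fun v => by
    have h1 := hφ v
    rw [hnorm, ← mul_pow] at h1
    have h2 := sq_le_sq.1 h1
    rwa [abs_mul, abs_norm] at h2
  refine ⟨(InnerProductSpace.toDual ℝ V).symm φc, fun v => ?_⟩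
  exact InnerProductSpace.toDual_symm_apply (x := v) (y := φc)

namespace DirichletForm

variable (E : DirichletForm m)

/-- The weak form of `(L + lam) u = lam f`, solved by the Riesz theorem for `E + lam ⟨·, ·⟩`, a
complete inner product on `D(E)` because the form is closed. -/
theorem exists_form_add_inner_eq {lam : ℝ} (hl : 0 < lam) (f : Lp ℝ 2 m) :
    ∃ u : E.domain, ∀ v : E.domain,
      E.form u v + lam * inner ℝ (u : Lp ℝ 2 m) (v : Lp ℝ 2 m) = lam * inner ℝ f (v : Lp ℝ 2 m) := by
  let B : E.domain →ₗ[ℝ] E.domain →ₗ[ℝ] ℝ :=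
    E.form + lam • (innerₗ (Lp ℝ 2 m)).compl₁₂ E.domain.subtype E.domain.subtype
  have hB : ∀ u v, B u v = E.form u v + lam * inner ℝ (u : Lp ℝ 2 m) (v : Lp ℝ 2 m) :=
    fun u v => by simp [B]
  have hBB : ∀ u, B u u = E.form u u + lam * ‖(u : Lp ℝ 2 m)‖ ^ 2 := fun u => by
    rw [hB, real_inner_self_eq_norm_sq]
  have hle : ∀ u : E.domain, lam * ‖(u : Lp ℝ 2 m)‖ ^ 2 ≤ B u u := fun u => by
    have := E.nonneg u
    rw [hBB]; linarith
  have hle' : ∀ u : E.domain, E.form u u ≤ B u u := fun u => by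
    rw [hBB]
    have : 0 ≤ lam * ‖(u : Lp ℝ 2 m)‖ ^ 2 := by positivity
    linarith
  obtain ⟨u, hu⟩ := exists_bilin_eq B (fun u v => by rw [hB, hB, E.symm, real_inner_comm])
    (fun u => (E.nonneg u).trans (hle' u))
    (fun u h => by
      have h1 := hle u
      rw [h] at h1
      have h2 : ‖(u : Lp ℝ 2 m)‖ = 0 := by
        by_contra hc
        have h3 : 0 < ‖(u : Lp ℝ 2 m)‖ := lt_of_le_of_ne (norm_nonneg _) (Ne.symm hc)
        have : 0 < lam * ‖(u : Lp ℝ 2 m)‖ ^ 2 := by positivity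
        linarith
      rw [norm_eq_zero] at h2
      exact Subtype.ext h2)
    (fun u hu => by
      obtain ⟨v, hv1, hv2⟩ := E.closed u (by
        rw [Metric.cauchySeq_iff]
        intro ε hε
        obtain ⟨N, hN⟩ := hu (lam * ε ^ 2) (by positivity)
        refine ⟨N, fun n hn k hk => ?_⟩
        have h1 := (hle (u n - u k)).trans_lt (hN n hn k hk)
        rw [dist_eq_norm]
        exact lt_of_pow_lt_pow_left₀ 2 hε.le (lt_of_mul_lt_mul_left h1 hl.le))
        (fun ε hε => by
          obtain ⟨N, hN⟩ := hu ε hε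
          exact ⟨N, fun n hn k hk => (hle' _).trans_lt (hN n hn k hk)⟩)
      refine ⟨v, ?_⟩
      have h2 := (tendsto_iff_norm_sub_tendsto_zero.1 hv1).pow 2
      have h3 := hv2.add (h2.const_mul lam)
      simp only [ne_eq, OfNat.ofNat_ne_zero, not_false_eq_true, zero_pow, mul_zero, add_zero] at h3
      exact h3.congr fun n => (hBB (u n - v)).symm)
    (lam • (innerₗ (Lp ℝ 2 m) f).comp E.domain.subtype) (C := Real.sqrt lam * ‖f‖)
    (fun v => by
      have h1 : (inner ℝ f (v : Lp ℝ 2 m)) ^ 2 ≤ (‖f‖ * ‖(v : Lp ℝ 2 m)‖) ^ 2 :=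
        sq_le_sq' (neg_le_of_abs_le (abs_real_inner_le_norm _ _)) (real_inner_le_norm _ _)
      have h2 := mul_le_mul_of_nonneg_left (hle v) (by positivity : 0 ≤ lam * ‖f‖ ^ 2)
      rw [mul_pow, Real.sq_sqrt hl.le]
      have h3 : (lam • (innerₗ (Lp ℝ 2 m) f).comp E.domain.subtype) v
        = lam * inner ℝ f (v : Lp ℝ 2 m) := by simp
      rw [h3]
      have h4 := mul_le_mul_of_nonneg_left h1 (sq_nonneg lam)
      nlinarith)
  refine ⟨u, fun v => ?_⟩
  rw [← hB, hu]
  simp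

theorem exists_resolvent {lam : ℝ} (hl : 0 < lam) : ∃ G : Lp ℝ 2 m →L[ℝ] Lp ℝ 2 m,
    ∀ f, E.Generator (G f) (lam • (f - G f)) := by
  choose u hu using E.exists_form_add_inner_eq hl
  have huniq : ∀ w : E.domain, (∀ v : E.domain,
      E.form w v + lam * inner ℝ (w : Lp ℝ 2 m) (v : Lp ℝ 2 m) = 0) → w = 0 := by
    intro w hw
    have h1 := hw w
    have h2 := E.nonneg w
    rw [real_inner_self_eq_norm_sq] at h1
    have h3 : ‖(w : Lp ℝ 2 m)‖ = 0 := by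
      by_contra hc
      have h3 : 0 < ‖(w : Lp ℝ 2 m)‖ := lt_of_le_of_ne (norm_nonneg _) (Ne.symm hc)
      have : 0 < lam * ‖(w : Lp ℝ 2 m)‖ ^ 2 := by positivity
      linarith
    rw [norm_eq_zero] at h3
    exact Subtype.ext h3
  let G : Lp ℝ 2 m →ₗ[ℝ] Lp ℝ 2 m :=
    { toFun := fun f => u f
      map_add' := fun f g => by
        have h := huniq (u (f + g) - (u f + u g)) fun v => by
          have h1 := hu (f + g) v
          have h2 := hu f v
          have h3 := hu g v
          rw [inner_add_left] at h1
          rw [map_sub, map_add, LinearMap.sub_apply, LinearMap.add_apply, Submodule.coe_sub,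
            Submodule.coe_add, inner_sub_left, inner_add_left]
          linarith
        rw [sub_eq_zero] at h
        rw [h, Submodule.coe_add]
      map_smul' := fun r f => by
        have h := huniq (u (r • f) - r • u f) fun v => by
          have h1 := hu (r • f) v
          have h2 := hu f v
          rw [inner_smul_left, RCLike.conj_to_real] at h1
          rw [map_sub, map_smul, LinearMap.sub_apply, LinearMap.smul_apply, Submodule.coe_sub,
            Submodule.coe_smul, inner_sub_left, inner_smul_left, RCLike.conj_to_real, smul_eq_mul]
          linear_combination h1 - r * h2
        rw [sub_eq_zero] at h
        rw [h, Submodule.coe_smul, RingHom.id_apply] }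
  refine ⟨G.mkContinuous 1 fun f => ?_, fun f => ⟨(u f).2, fun v => ?_⟩⟩
  · rw [one_mul]
    change ‖(u f : Lp ℝ 2 m)‖ ≤ ‖f‖
    have h1 := hu f (u f)
    have h2 := E.nonneg (u f)
    rw [real_inner_self_eq_norm_sq] at h1
    have h3 := real_inner_le_norm f (u f : Lp ℝ 2 m)
    by_contra! hc
    have h0 : 0 < ‖(u f : Lp ℝ 2 m)‖ := (norm_nonneg f).trans_lt hc
    have h4 : ‖f‖ * ‖(u f : Lp ℝ 2 m)‖ < ‖(u f : Lp ℝ 2 m)‖ ^ 2 := by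
      rw [sq]; gcongr
    nlinarith
  · change E.form (u f) v = inner ℝ (lam • (f - (u f : Lp ℝ 2 m))) (v : Lp ℝ 2 m)
    rw [inner_smul_left, RCLike.conj_to_real, inner_sub_left]
    linarith [hu f v]

open Classical in
/-- The operator `lam (lam + L)⁻¹` for `lam > 0`. -/
noncomputable def resolvent (lam : ℝ) : Lp ℝ 2 m →L[ℝ] Lp ℝ 2 m :=
  if h : 0 < lam then (E.exists_resolvent h).choose else 0

theorem generator_resolvent {lam : ℝ} (hl : 0 < lam) (f : Lp ℝ 2 m) :
    E.Generator (E.resolvent lam f) (lam • (f - E.resolvent lam f)) := by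
  rw [resolvent, dif_pos hl]
  exact (E.exists_resolvent hl).choose_spec f

/-- The operator of a Dirichlet form is nonnegative, densely defined and maximal. -/
theorem isMaximalAccretive : IsMaximalAccretive E.Generator E.resolvent where
  sub := by
    rintro f g f' g' ⟨hf, h⟩ ⟨hf', h'⟩
    refine ⟨E.domain.sub_mem hf hf', fun v => ?_⟩
    have e : (⟨f - f', E.domain.sub_mem hf hf'⟩ : E.domain) = ⟨f, hf⟩ - ⟨f', hf'⟩ := rfl
    rw [e, map_sub, LinearMap.sub_apply, h, h', inner_sub_left]
  accretive := by
    rintro f g ⟨hf, h⟩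
    rw [← h ⟨f, hf⟩]
    exact E.nonneg _
  resolvent := fun hl f => E.generator_resolvent hl f
  dense := by
    rw [Metric.dense_iff]
    intro f ε hε
    obtain ⟨w, hw, hwd⟩ := Metric.dense_iff.1 E.dense_domain f (ε / 2) (by positivity)
    rw [Metric.mem_ball] at hw
    set c := E.form ⟨w, hwd⟩ ⟨w, hwd⟩ with hc
    have hc0 : 0 ≤ c := E.nonneg _
    -- `lam ‖J lam w - w‖² ≤ E(w, w)` for `w ∈ D(E)`, so this `lam` makes `J lam w` close to `w`.
    set lam := (c + 1) / (ε / 2) ^ 2 with hlam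
    have hl : 0 < lam := by positivity
    have hgen := E.generator_resolvent hl w
    refine ⟨E.resolvent lam w, ?_, _, hgen⟩
    obtain ⟨hu, h⟩ := hgen
    set u := E.resolvent lam w
    have h1 := h (⟨u, hu⟩ - ⟨w, hwd⟩)
    have h2 := E.nonneg (⟨u, hu⟩ - ⟨w, hwd⟩)
    have h3 : inner ℝ (lam • (w - u)) (u - w) = - (lam * ‖u - w‖ ^ 2) := by
      rw [inner_smul_left, RCLike.conj_to_real, ← neg_sub u w, inner_neg_left,
        real_inner_self_eq_norm_sq]
      ring
    rw [Submodule.coe_sub, h3] at h1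
    have h4 := E.symm ⟨w, hwd⟩ ⟨u, hu⟩
    have h5 := E.nonneg ⟨u, hu⟩
    simp only [map_sub, LinearMap.sub_apply] at h1 h2
    have h6 : lam * ‖u - w‖ ^ 2 < c + 1 := by linarith
    have h7 : ‖u - w‖ < ε / 2 := by
      refine lt_of_pow_lt_pow_left₀ 2 (by positivity) ?_
      rw [hlam, div_mul_eq_mul_div, div_lt_iff₀ (by positivity)] at h6
      exact lt_of_mul_lt_mul_left h6 (by positivity)
    rw [Metric.mem_ball]
    have := dist_triangle u w f
    rw [dist_eq_norm u w] at this
    linarith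

theorem resolvent_symm {lam : ℝ} (hl : 0 < lam) (f g : Lp ℝ 2 m) :
    inner ℝ (E.resolvent lam f) g = inner ℝ f (E.resolvent lam g) := by
  obtain ⟨hu, h⟩ := E.generator_resolvent hl f
  obtain ⟨hv, h'⟩ := E.generator_resolvent hl g
  have h1 := h ⟨_, hv⟩
  have h2 := h' ⟨_, hu⟩
  rw [E.symm, h2] at h1
  simp only [inner_smul_left, RCLike.conj_to_real, inner_sub_left] at h1
  have h3 := mul_left_cancel₀ hl.ne' h1
  rw [real_inner_comm g (E.resolvent lam f)]
  rw [real_inner_comm (E.resolvent lam f) (E.resolvent lam g)] at h3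
  linarith

/-- `u = lam (lam + L)⁻¹ f` is the minimizer of `E(v, v) + lam ‖v - f‖²`, and for `0 ≤ f ≤ 1` the
unit contraction of `u` does not increase this functional. -/
theorem resolvent_mem_unitInterval2 {lam : ℝ} (hl : 0 < lam) {f : Lp ℝ 2 m}
    (hf : f ∈ unitInterval2 m) : E.resolvent lam f ∈ unitInterval2 m := by
  obtain ⟨hu, h⟩ := E.generator_resolvent hl f
  set u := E.resolvent lam f
  obtain ⟨v, hv, hvE⟩ := E.markov ⟨u, hu⟩
  have hnorm : ‖(v : Lp ℝ 2 m) - f‖ ≤ ‖u - f‖ := by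
    refine Lp.norm_le_norm_of_ae_le ?_
    filter_upwards [hv, hf, Lp.coeFn_sub (v : Lp ℝ 2 m) f, Lp.coeFn_sub u f] with x h1 h2 h3 h4
    rw [h3, h4, Pi.sub_apply, Pi.sub_apply, h1, Real.norm_eq_abs, Real.norm_eq_abs]
    obtain ⟨h5, h6⟩ := h2
    change |min (max (u x) 0) 1 - f x| ≤ |u x - f x|
    have e : f x = min (max (f x) 0) 1 := by rw [max_eq_left h5, min_eq_left h6]
    nth_rewrite 1 [e]
    exact (abs_min_sub_min_le_max _ _ _ _).trans (by
      rw [sub_self, abs_zero, max_eq_left (abs_nonneg _)]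
      exact (abs_max_sub_max_le_max _ _ _ _).trans (by
        rw [sub_self, abs_zero, max_eq_left (abs_nonneg _)]))
  have h1 := h (v - ⟨u, hu⟩)
  have h2 := E.nonneg (v - ⟨u, hu⟩)
  rw [Submodule.coe_sub, inner_smul_left, RCLike.conj_to_real] at h1
  simp only [map_sub, LinearMap.sub_apply] at h1 h2
  have h3 := E.symm v ⟨u, hu⟩
  have h4 : ‖(v : Lp ℝ 2 m) - f‖ ^ 2
      = ‖(v : Lp ℝ 2 m) - u‖ ^ 2 - 2 * inner ℝ (f - u) ((v : Lp ℝ 2 m) - u) + ‖u - f‖ ^ 2 := by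
    have e : (v : Lp ℝ 2 m) - f = ((v : Lp ℝ 2 m) - u) - (f - u) := by abel
    rw [e, norm_sub_sq_real, norm_sub_rev u f, real_inner_comm]
  -- The first variation of the functional vanishes at `u`, so `v` is at least as good a minimizer
  -- only if `v = u`.
  have h5 : ‖(v : Lp ℝ 2 m) - f‖ ^ 2 ≤ ‖u - f‖ ^ 2 := by gcongr
  have h6 : ‖(v : Lp ℝ 2 m) - u‖ = 0 := by
    by_contra hc
    have h7 : 0 < ‖(v : Lp ℝ 2 m) - u‖ := lt_of_le_of_ne (norm_nonneg _) (Ne.symm hc)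
    have h8 : 0 < lam * ‖(v : Lp ℝ 2 m) - u‖ ^ 2 := by positivity
    have h9 := mul_le_mul_of_nonneg_left h5 hl.le
    rw [h4] at h9
    nlinarith
  rw [norm_eq_zero, sub_eq_zero] at h6
  rw [← h6]
  filter_upwards [hv] with x hx
  rw [hx]
  exact ⟨le_min (le_max_right _ _) zero_le_one, min_le_right _ _⟩

/-- The semigroup of the form exists, by the Hille-Yosida theorem. -/
theorem isAssociatedSemigroup_semigroup : E.IsAssociatedSemigroup E.semigroup := by
  have h : ∃ T, E.IsAssociatedSemigroup T := by
    obtain ⟨T, hT, hTA, -⟩ := E.isMaximalAccretive.exists_semigroup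
    exact ⟨T, hT, hTA⟩
  rw [semigroup, dif_pos h]
  exact h.choose_spec

theorem isSymmetricMarkov_semigroup (t : ℝ≥0) : IsSymmetricMarkov (E.semigroup t) where
  symm := E.isMaximalAccretive.semigroup_symm E.isAssociatedSemigroup_semigroup.1
    E.isAssociatedSemigroup_semigroup.2 (fun _ hl f g => E.resolvent_symm hl f g) t
  markov := fun _ hf => E.isMaximalAccretive.semigroup_mem E.isAssociatedSemigroup_semigroup.1
    E.isAssociatedSemigroup_semigroup.2 convex_unitInterval2 isClosed_unitInterval2
    zero_mem_unitInterval2 (fun _ hl _ hf => E.resolvent_mem_unitInterval2 hl hf) t hf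

end DirichletForm
end Forms

/-! ### Symmetric Markov operators on `L^p` -/

section MarkovOperators

variable {X : Type*} [MeasurableSpace X] {m : Measure X}

theorem inner_L2_eq_integral (f g : Lp ℝ 2 m) : inner ℝ f g = ∫ x, f x * g x ∂m := by
  rw [L2.inner_def]
  simp [mul_comm]

theorem integrable_mul_L2 (f g : Lp ℝ 2 m) : Integrable (fun x => f x * g x) m := by
  have := L2.integrable_inner (𝕜 := ℝ) f g
  simpa [mul_comm] using this

/-- A closed property of nonnegative functions in `L^p(m)`, `p < ∞`, can be checked on nonnegative
simple functions. -/
theorem Lp_nonneg_induction {p : ℝ≥0∞} [Fact (1 ≤ p)] (hp : p ≠ ∞) {P : Lp ℝ p m → Prop}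
    (hcl : IsClosed {f | P f})
    (hs : ∀ (s : SimpleFunc X ℝ) (hs : MemLp s p m), 0 ≤ s → P (hs.toLp s)) {f : Lp ℝ p m}
    (hf : 0 ≤ f) : P f := by
  have hd := Lp.simpleFunc.denseRange_coeSimpleFuncNonnegToLpNonneg p m ℝ hp
  have hcl' : IsClosed {g : { g : Lp ℝ p m // 0 ≤ g } | P g} := hcl.preimage continuous_subtype_val
  refine hd.induction_on (p := fun g => P g) ⟨f, hf⟩ hcl' ?_
  rintro ⟨g, hg⟩
  obtain ⟨s, hs0, hgs⟩ := Lp.simpleFunc.exists_simpleFunc_nonneg_ae_eq hg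
  have hmem : MemLp s p m := (memLp_congr_ae hgs).1 (Lp.memLp (g : Lp ℝ p m))
  have e : (g : Lp ℝ p m) = hmem.toLp s := Lp.ext (hgs.trans hmem.coeFn_toLp.symm)
  change P (g : Lp ℝ p m)
  rw [e]
  exact hs s hmem hs0

theorem SimpleFunc_memLp_of_memLp {s : SimpleFunc X ℝ} {p q : ℝ≥0∞} (hp0 : p ≠ 0) (hp : p ≠ ∞)
    (hq0 : q ≠ 0) (hq : q ≠ ∞) (hs : MemLp s p m) : MemLp s q m :=
  (SimpleFunc.memLp_iff_finMeasSupp hq0 hq).2 ((SimpleFunc.memLp_iff_finMeasSupp hp0 hp).1 hs)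

theorem SimpleFunc_memLp_map {s : SimpleFunc X ℝ} {p : ℝ≥0∞} (hp0 : p ≠ 0) (hp : p ≠ ∞)
    {φ : ℝ → ℝ} (hφ : φ 0 = 0) (hs : MemLp s p m) : MemLp (s.map φ) p m :=
  (SimpleFunc.memLp_iff_finMeasSupp hp0 hp).2
    (((SimpleFunc.memLp_iff_finMeasSupp hp0 hp).1 hs).map hφ)

/-- The tangent to the convex function `x ↦ x ^ r` at `a` lies below its graph. -/
theorem mul_rpow_sub_le_rpow {r x a : ℝ} (hr : 1 ≤ r) (hx : 0 ≤ x) (ha : 0 < a) :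
    r * a ^ (r - 1) * x - (r - 1) * a ^ r ≤ x ^ r := by
  have h := one_add_mul_self_le_rpow_one_add (s := x / a - 1) (p := r)
    (by have : 0 ≤ x / a := by positivity
        linarith) hr
  rw [add_sub_cancel, Real.div_rpow hx ha.le, le_div_iff₀ (by positivity)] at h
  have e : a ^ (r - 1) = a ^ r / a := by rw [Real.rpow_sub_one ha.ne']
  rw [e]
  refine le_trans (le_of_eq ?_) h
  field_simp
  ring

/-- Conversely `x ↦ x ^ r` is the supremum of its tangents, at rational points even. -/
theorem rpow_le_of_tangents_le {r y z : ℝ} (hr : 1 ≤ r) (hy : 0 ≤ y) (hz : 0 ≤ z)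
    (h : ∀ a : ℚ, 0 < a → r * (a : ℝ) ^ (r - 1) * y - (r - 1) * (a : ℝ) ^ r ≤ z) : y ^ r ≤ z := by
  rcases hy.eq_or_lt with rfl | hy
  · rwa [Real.zero_rpow (by linarith)]
  by_contra! hc
  have hcont : ContinuousAt (fun a : ℝ => r * a ^ (r - 1) * y - (r - 1) * a ^ r) y :=
    ((continuousAt_const.mul (Real.continuousAt_rpow_const _ _ (Or.inl hy.ne'))).mul
      continuousAt_const).sub
      (continuousAt_const.mul (Real.continuousAt_rpow_const _ _ (Or.inl hy.ne')))
  have hval : r * y ^ (r - 1) * y - (r - 1) * y ^ r = y ^ r := by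
    rw [Real.rpow_sub_one hy.ne']
    field_simp
    ring
  have hev : ∀ᶠ a in 𝓝 y, z < r * a ^ (r - 1) * y - (r - 1) * a ^ r :=
    hcont.eventually_const_lt (by beta_reduce; rw [hval]; exact hc)
  obtain ⟨U, hU, hUo, hyU⟩ := mem_nhds_iff.1 (hev.and (lt_mem_nhds hy))
  obtain ⟨a, ha⟩ := Rat.denseRange_cast.exists_mem_open hUo ⟨y, hyU⟩
  obtain ⟨h1, h2⟩ := hU ha
  exact absurd (h a (by exact_mod_cast h2)) (not_le.2 h1)

namespace IsSymmetricMarkov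

variable {T : Lp ℝ 2 m →L[ℝ] Lp ℝ 2 m} (hT : IsSymmetricMarkov T)
include hT

theorem le_const {c : ℝ} (hc : 0 ≤ c) {f : Lp ℝ 2 m} (hf : ∀ᵐ x ∂m, 0 ≤ f x ∧ f x ≤ c) :
    ∀ᵐ x ∂m, 0 ≤ T f x ∧ T f x ≤ c := by
  rcases hc.eq_or_lt with rfl | hc
  · have : f = 0 := by
      refine Lp.ext ?_
      filter_upwards [hf, Lp.coeFn_zero ℝ 2 m] with x h1 h2
      rw [h2]
      exact le_antisymm h1.2 h1.1
    rw [this, map_zero]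
    filter_upwards [Lp.coeFn_zero ℝ 2 m] with x h2
    rw [h2]
    simp
  · have h1 : c⁻¹ • f ∈ unitInterval2 m := by
      filter_upwards [hf, Lp.coeFn_smul c⁻¹ f] with x h1 h2
      rw [h2, Pi.smul_apply, smul_eq_mul, inv_mul_le_one₀ hc]
      exact ⟨mul_nonneg (by positivity) h1.1, h1.2⟩
    have h2 := hT.markov _ h1
    rw [map_smul] at h2
    filter_upwards [h2, Lp.coeFn_smul c⁻¹ (T f)] with x h3 h4
    rw [h4, Pi.smul_apply, smul_eq_mul, inv_mul_le_one₀ hc] at h3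
    exact ⟨nonneg_of_mul_nonneg_right h3.1 (by positivity), h3.2⟩

theorem nonneg {f : Lp ℝ 2 m} (hf : 0 ≤ f) : 0 ≤ T f := by
  refine Lp_nonneg_induction (P := fun f => 0 ≤ T f) (by simp)
    (isClosed_le continuous_const T.continuous) (fun s hs hs0 => ?_) hf
  obtain ⟨c, hc⟩ := s.exists_forall_norm_le
  have h := hT.le_const (c := max c 0) (le_max_right _ _) (f := hs.toLp s) (by
    filter_upwards [hs.coeFn_toLp] with x hx
    rw [hx]
    exact ⟨hs0 x, ((Real.le_norm_self _).trans (hc x)).trans (le_max_left _ _)⟩)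
  rw [← Lp.coeFn_nonneg]
  filter_upwards [h] with x hx using hx.1

theorem mono {f g : Lp ℝ 2 m} (hfg : f ≤ g) : T f ≤ T g := by
  have := hT.nonneg (sub_nonneg.2 hfg)
  rwa [map_sub, sub_nonneg] at this

theorem abs_le (f : Lp ℝ 2 m) : |T f| ≤ T |f| :=
  abs_le'.2 ⟨hT.mono (le_abs_self f), by rw [← map_neg]; exact hT.mono (neg_le_abs f)⟩

theorem indicator_mem {A : Set X} (hA : MeasurableSet A) (hm : m A ≠ ∞) :
    ∀ᵐ x ∂m, 0 ≤ T (indicatorConstLp 2 hA hm 1) x ∧ T (indicatorConstLp 2 hA hm 1) x ≤ 1 := by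
  refine hT.markov _ ?_
  filter_upwards [indicatorConstLp_coeFn (p := 2) (hs := hA) (hμs := hm) (c := (1 : ℝ))] with x hx
  rw [hx]
  by_cases h : x ∈ A <;> simp [h]

/-- By symmetry, `∫_A T g = ⟨T 1_A, g⟩ ≤ ∫ g` for all sets `A` of finite measure. -/
theorem lintegral_le [SigmaFinite m] {g : Lp ℝ 2 m} (hg : 0 ≤ g) :
    ∫⁻ x, ENNReal.ofReal (T g x) ∂m ≤ ∫⁻ x, ENNReal.ofReal (g x) ∂m := by
  have hTg := (Lp.coeFn_nonneg _).2 (hT.nonneg hg)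
  have hg' := (Lp.coeFn_nonneg _).2 hg
  have key : ∀ n, ∫⁻ x in spanningSets m n, ENNReal.ofReal (T g x) ∂m
      ≤ ∫⁻ x, ENNReal.ofReal (g x) ∂m := by
    intro n
    have hA := measurableSet_spanningSets m n
    have hm := (measure_spanningSets_lt_top m n).ne
    have hm' : Fact (m (spanningSets m n) < ∞) := ⟨measure_spanningSets_lt_top m n⟩
    rw [← ofReal_integral_eq_lintegral_ofReal
      (integrableOn_Lp_of_measure_ne_top (T g) (by norm_num) hm) (ae_restrict_of_ae hTg),
      ← L2.inner_indicatorConstLp_one (𝕜 := ℝ) hA hm, ← hT.symm, inner_L2_eq_integral,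
      ofReal_integral_eq_lintegral_ofReal (integrable_mul_L2 _ _)]
    · refine lintegral_mono_ae ?_
      filter_upwards [hT.indicator_mem hA hm, hg'] with x h1 h2
      exact ENNReal.ofReal_le_ofReal (mul_le_of_le_one_left h2 h1.2)
    · filter_upwards [hT.indicator_mem hA hm, hg'] with x h1 h2
      exact mul_nonneg h1.1 h2
  rw [← setLIntegral_univ, ← iUnion_spanningSets m, setLIntegral_iUnion_of_directed _
    (monotone_spanningSets m).directed_le]
  exact iSup_le key

/-- Jensen's inequality `(T s)^r ≤ T (s^r)` for a sub-Markovian operator: apply `T` to the tangents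
`r a^(r-1) s - (r-1) a^r 1_{s ≠ 0} ≤ s^r` and use `T 1_{s ≠ 0} ≤ 1`. Only countably many `a` may be
used, as each inequality holds off a null set of its own. -/
theorem rpow_le {r : ℝ} (hr : 1 ≤ r) {s : SimpleFunc X ℝ} (hs0 : 0 ≤ s) (hs : MemLp s 2 m)
    (hsr : MemLp (s.map (· ^ r)) 2 m) :
    ∀ᵐ x ∂m, (T (hs.toLp s) x) ^ r ≤ T (hsr.toLp _) x := by
  have hA : MeasurableSet (Function.support s) := s.measurableSet_preimage {0}ᶜ
  have hm : m (Function.support s) ≠ ∞ :=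
    (s.measure_support_lt_top_of_memLp hs (by simp) (by simp)).ne
  set I := indicatorConstLp 2 hA hm (1 : ℝ)
  have hI := indicatorConstLp_coeFn (p := 2) (hs := hA) (hμs := hm) (c := (1 : ℝ))
  have h1 : ∀ a : ℚ, 0 < a → ∀ᵐ x ∂m,
      r * (a : ℝ) ^ (r - 1) * T (hs.toLp s) x - (r - 1) * (a : ℝ) ^ r ≤ T (hsr.toLp _) x := by
    intro a ha
    have ha' : (0 : ℝ) < a := by exact_mod_cast ha
    have hle : (r * (a : ℝ) ^ (r - 1)) • hs.toLp s - ((r - 1) * (a : ℝ) ^ r) • I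
        ≤ hsr.toLp _ := by
      rw [← Lp.coeFn_le]
      filter_upwards [Lp.coeFn_sub ((r * (a : ℝ) ^ (r - 1)) • hs.toLp s)
        (((r - 1) * (a : ℝ) ^ r) • I), Lp.coeFn_smul (r * (a : ℝ) ^ (r - 1)) (hs.toLp s),
        Lp.coeFn_smul ((r - 1) * (a : ℝ) ^ r) I, hs.coeFn_toLp, hsr.coeFn_toLp, hI]
        with x e1 e2 e3 e4 e5 e6
      rw [e1, Pi.sub_apply, e2, e3, Pi.smul_apply, Pi.smul_apply, e4, e5, e6, smul_eq_mul,
        smul_eq_mul, SimpleFunc.map_apply]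
      by_cases hx : s x = 0
      · have : x ∉ Function.support s := by simpa using hx
        rw [Set.indicator_of_notMem this, hx, Real.zero_rpow (by linarith)]
        simp
      · have : x ∈ Function.support s := by simpa using hx
        rw [Set.indicator_of_mem this, mul_one]
        exact mul_rpow_sub_le_rpow hr (hs0 x) ha'
    have h2 := (Lp.coeFn_le _ _).2 (hT.mono hle)
    rw [map_sub, map_smul, map_smul] at h2
    filter_upwards [h2, Lp.coeFn_sub ((r * (a : ℝ) ^ (r - 1)) • T (hs.toLp s))
        (((r - 1) * (a : ℝ) ^ r) • T I), Lp.coeFn_smul (r * (a : ℝ) ^ (r - 1)) (T (hs.toLp s)),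
        Lp.coeFn_smul ((r - 1) * (a : ℝ) ^ r) (T I), hT.indicator_mem hA hm]
        with x e0 e1 e2 e3 e4
    rw [e1, Pi.sub_apply, e2, e3, Pi.smul_apply, Pi.smul_apply, smul_eq_mul, smul_eq_mul] at e0
    refine le_trans ?_ e0
    exact sub_le_sub_left (mul_le_of_le_one_right
      (mul_nonneg (sub_nonneg.2 hr) (Real.rpow_nonneg ha'.le r)) e4.2) _
  have hnn : ∀ {f : SimpleFunc X ℝ} (hf : MemLp f 2 m), 0 ≤ f → 0 ≤ᵐ[m] T (hf.toLp f) := by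
    intro f hf h0
    refine (Lp.coeFn_nonneg _).2 (hT.nonneg ((Lp.coeFn_nonneg _).1 ?_))
    filter_upwards [hf.coeFn_toLp] with x hx
    rw [hx]
    exact h0 x
  filter_upwards [ae_all_iff.2 fun a : ℚ => eventually_imp_distrib_left.2 (h1 a), hnn hs hs0,
    hnn hsr fun x => Real.rpow_nonneg (hs0 x) r] with x e1 e2 e3
  exact rpow_le_of_tangents_le hr e2 e3 e1

end IsSymmetricMarkov
end MarkovOperators

/-! ### Extension to `L^p` -/

section LpExtension

variable {X : Type*} [MeasurableSpace X] {m : Measure X} {p : ℝ≥0∞} [Fact (1 ≤ p)]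

theorem dense_memLp_two (hp : p ≠ ∞) : Dense {v : Lp ℝ p m | MemLp v 2 m} := by
  refine (Lp.simpleFunc.dense (E := ℝ) (μ := m) hp).mono fun v hv => ?_
  have h1 := Lp.simpleFunc.toSimpleFunc_eq_toFun ⟨v, hv⟩
  have h2 := Lp.simpleFunc.memLp ⟨v, hv⟩
  exact (memLp_congr_ae h1).1 (SimpleFunc_memLp_of_memLp (zero_lt_one.trans_le Fact.out).ne' hp
    (by simp) (by simp) h2)

namespace IsSymmetricMarkov

variable {T : Lp ℝ 2 m →L[ℝ] Lp ℝ 2 m} (hT : IsSymmetricMarkov T) [SigmaFinite m]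
include hT

/-- The combination of `|T s|^p ≤ (T |s|)^p ≤ T (|s|^p)` and `∫ T (|s|^p) ≤ ∫ |s|^p`. -/
theorem eLpNorm_simpleFunc_le (hp : p ≠ ∞) {s : SimpleFunc X ℝ} (hs : MemLp s 2 m) :
    eLpNorm (T (hs.toLp s)) p m ≤ eLpNorm s p m := by
  have hp0 : p ≠ 0 := (zero_lt_one.trans_le Fact.out).ne'
  have hr : 1 ≤ p.toReal := by
    rw [← ENNReal.toReal_one]
    exact ENNReal.toReal_mono hp Fact.out
  have ht : MemLp (s.map abs) 2 m := SimpleFunc_memLp_map (by simp) (by simp) abs_zero hs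
  have ht0 : 0 ≤ s.map abs := fun x => abs_nonneg (s x)
  have htr : MemLp ((s.map abs).map (· ^ p.toReal)) 2 m :=
    SimpleFunc_memLp_map (by simp) (by simp) (Real.zero_rpow (by linarith)) ht
  have htr0 : 0 ≤ htr.toLp _ := by
    rw [← Lp.coeFn_nonneg]
    filter_upwards [htr.coeFn_toLp] with x hx
    rw [hx]
    exact Real.rpow_nonneg (ht0 x) _
  have habs : |hs.toLp s| = ht.toLp _ := by
    refine Lp.ext ?_
    filter_upwards [Lp.coeFn_abs (hs.toLp s), hs.coeFn_toLp, ht.coeFn_toLp] with x h1 h2 h3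
    rw [h1, h2, h3]
    rfl
  have hle : ∀ᵐ x ∂m, ‖T (hs.toLp s) x‖ ≤ T (ht.toLp _) x := by
    have := hT.abs_le (hs.toLp s)
    rw [habs, ← Lp.coeFn_le] at this
    filter_upwards [this, Lp.coeFn_abs (T (hs.toLp s))] with x h1 h2
    rwa [h2] at h1
  rw [eLpNorm_eq_lintegral_rpow_enorm_toReal hp0 hp, eLpNorm_eq_lintegral_rpow_enorm_toReal hp0 hp]
  refine ENNReal.rpow_le_rpow ?_ (by positivity)
  calc ∫⁻ x, ‖T (hs.toLp s) x‖ₑ ^ p.toReal ∂m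
      ≤ ∫⁻ x, ENNReal.ofReal (T (htr.toLp _) x) ∂m := by
        refine lintegral_mono_ae ?_
        filter_upwards [hle, hT.rpow_le hr ht0 ht htr] with x h1 h2
        rw [← ofReal_norm, ENNReal.ofReal_rpow_of_nonneg (norm_nonneg _) (by linarith)]
        refine ENNReal.ofReal_le_ofReal (le_trans ?_ h2)
        gcongr
    _ ≤ ∫⁻ x, ENNReal.ofReal (htr.toLp _ x) ∂m := hT.lintegral_le htr0
    _ = ∫⁻ x, ‖s x‖ₑ ^ p.toReal ∂m := by
        refine lintegral_congr_ae ?_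
        filter_upwards [htr.coeFn_toLp] with x hx
        rw [hx, ← ofReal_norm, ENNReal.ofReal_rpow_of_nonneg (norm_nonneg _) (by linarith)]
        rfl

/-- The operator contracts the `L^p` norm. The bound for simple functions passes to the limit by
Fatou's lemma, because the standard approximations by simple functions converge both in `L²` and
in `L^p`. -/
theorem eLpNorm_le (hp : p ≠ ∞) {u : Lp ℝ 2 m} (hu : MemLp u p m) :
    eLpNorm (T u) p m ≤ eLpNorm u p m := by
  have hm : Measurable u := (Lp.stronglyMeasurable u).measurable
  set s : ℕ → SimpleFunc X ℝ := fun n => SimpleFunc.approxOn u hm (Set.range u ∪ {0}) 0 (by simp) n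
  have hs : ∀ n, MemLp (s n) 2 m := SimpleFunc.memLp_approxOn_range hm (Lp.memLp u)
  have h2 : Tendsto (fun n => (hs n).toLp (s n)) atTop (𝓝 u) := by
    have := SimpleFunc.tendsto_approxOn_range_Lp (p := 2) (by simp) hm (Lp.memLp u)
    rwa [Lp.toLp_coeFn] at this
  have hTs := (T.continuous.tendsto u).comp h2
  obtain ⟨φ, hφ, hae⟩ := (tendstoInMeasure_of_tendsto_Lp hTs).exists_seq_tendsto_ae
  have hlim : Tendsto (fun n => eLpNorm (⇑(s n) - ⇑u) p m + eLpNorm u p m) atTop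
      (𝓝 (eLpNorm u p m)) := by
    have := (SimpleFunc.tendsto_approxOn_range_Lp_eLpNorm hp hm hu.2).add_const (eLpNorm u p m)
    rwa [zero_add] at this
  calc eLpNorm (T u) p m
      ≤ liminf (fun n => eLpNorm (T ((hs (φ n)).toLp (s (φ n)))) p m) atTop :=
        Lp.eLpNorm_lim_le_liminf_eLpNorm (fun n => Lp.aestronglyMeasurable _) _ hae
    _ ≤ liminf (fun n => eLpNorm (⇑(s (φ n)) - ⇑u) p m + eLpNorm u p m) atTop := by
        refine liminf_le_liminf (Eventually.of_forall fun n => ?_)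
        refine (hT.eLpNorm_simpleFunc_le hp (hs (φ n))).trans ?_
        have e : (⇑(s (φ n)) : X → ℝ) = (⇑(s (φ n)) - ⇑u) + ⇑u := by simp
        nth_rewrite 1 [e]
        exact eLpNorm_add_le ((s (φ n)).aestronglyMeasurable.sub (Lp.aestronglyMeasurable u))
          (Lp.aestronglyMeasurable u) Fact.out
    _ = eLpNorm u p m := (hlim.comp hφ.tendsto_atTop).liminf_eq

/-- The operator, restricted to the dense subspace `L² ∩ L^p`, extends to a contraction of `L^p`. -/
theorem exists_agreeOnInter (hp : p ≠ ∞) :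
    ∃ S : Lp ℝ p m →L[ℝ] Lp ℝ p m, AgreeOnInter T S := by
  let D : Submodule ℝ (Lp ℝ p m) :=
    { carrier := {v | MemLp v 2 m}
      add_mem' := fun {v w} hv hw => (memLp_congr_ae (Lp.coeFn_add v w)).2 (MemLp.add hv hw)
      zero_mem' := (memLp_congr_ae (Lp.coeFn_zero ℝ p m)).2 MemLp.zero
      smul_mem' := fun c v hv => (memLp_congr_ae (Lp.coeFn_smul c v)).2 (MemLp.const_smul hv c) }
  have hD : ∀ v : D, MemLp (v : Lp ℝ p m) 2 m := fun v => v.2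
  have hle : ∀ v : D, eLpNorm (T ((hD v).toLp _)) p m ≤ eLpNorm (v : Lp ℝ p m) p m := fun v => by
    have h : MemLp ((hD v).toLp _) p m :=
      (memLp_congr_ae (hD v).coeFn_toLp).2 (Lp.memLp (v : Lp ℝ p m))
    exact (hT.eLpNorm_le hp h).trans (eLpNorm_congr_ae (hD v).coeFn_toLp).le
  have hmem : ∀ v : D, MemLp (T ((hD v).toLp _)) p m := fun v =>
    ⟨Lp.aestronglyMeasurable _, (hle v).trans_lt (Lp.eLpNorm_lt_top _)⟩
  let f : D →ₗ[ℝ] Lp ℝ p m :=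
    { toFun := fun v => (hmem v).toLp _
      map_add' := fun v w => by
        have e : (hD (v + w)).toLp _ = (hD v).toLp _ + (hD w).toLp _ := by
          refine Lp.ext ?_
          filter_upwards [(hD (v + w)).coeFn_toLp, (hD v).coeFn_toLp, (hD w).coeFn_toLp,
            Lp.coeFn_add ((hD v).toLp _) ((hD w).toLp _),
            Lp.coeFn_add (v : Lp ℝ p m) (w : Lp ℝ p m)] with x h1 h2 h3 h4 h5
          rw [h1, h4, Pi.add_apply, h2, h3, Submodule.coe_add, h5, Pi.add_apply]
        refine Lp.ext ?_
        filter_upwards [(hmem (v + w)).coeFn_toLp, (hmem v).coeFn_toLp, (hmem w).coeFn_toLp,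
          Lp.coeFn_add ((hmem v).toLp _) ((hmem w).toLp _),
          Lp.coeFn_add (T ((hD v).toLp _)) (T ((hD w).toLp _))] with x h1 h2 h3 h4 h5
        rw [h1, h4, Pi.add_apply, h2, h3, e, map_add, h5, Pi.add_apply]
      map_smul' := fun c v => by
        have e : (hD (c • v)).toLp _ = c • (hD v).toLp _ := by
          refine Lp.ext ?_
          filter_upwards [(hD (c • v)).coeFn_toLp, (hD v).coeFn_toLp,
            Lp.coeFn_smul c ((hD v).toLp _), Lp.coeFn_smul c (v : Lp ℝ p m)] with x h1 h2 h4 h5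
          rw [h1, h4, Pi.smul_apply, h2, Submodule.coe_smul, h5, Pi.smul_apply]
        refine Lp.ext ?_
        filter_upwards [(hmem (c • v)).coeFn_toLp, (hmem v).coeFn_toLp,
          Lp.coeFn_smul c ((hmem v).toLp _), Lp.coeFn_smul c (T ((hD v).toLp _))]
          with x h1 h2 h4 h5
        rw [h1, RingHom.id_apply, h4, Pi.smul_apply, h2, e, map_smul, h5, Pi.smul_apply] }
  have hbound : ∀ v, ‖f v‖ ≤ 1 * ‖D.subtype v‖ := fun v => by
    rw [one_mul]
    change ‖(hmem v).toLp _‖ ≤ ‖(v : Lp ℝ p m)‖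
    rw [Lp.norm_toLp, Lp.norm_def]
    exact ENNReal.toReal_mono (Lp.eLpNorm_ne_top _) (hle v)
  have hdense : DenseRange D.subtype := by
    have : Dense (D : Set (Lp ℝ p m)) := dense_memLp_two hp
    exact this.denseRange_val
  refine ⟨f.extendOfNorm D.subtype, fun u v huv => ?_⟩
  have hv : v ∈ D := (memLp_congr_ae huv).1 (Lp.memLp u)
  have h1 : f.extendOfNorm D.subtype v = f ⟨v, hv⟩ :=
    LinearMap.extendOfNorm_eq hdense ⟨1, hbound⟩ ⟨v, hv⟩
  have h2 : (hD ⟨v, hv⟩).toLp _ = u :=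
    Lp.ext ((hD ⟨v, hv⟩).coeFn_toLp.trans huv.symm)
  have h3 : (f ⟨v, hv⟩ : X → ℝ) =ᵐ[m] T ((hD ⟨v, hv⟩).toLp _) := (hmem ⟨v, hv⟩).coeFn_toLp
  rw [h2] at h3
  rw [h1]
  exact h3.symm

end IsSymmetricMarkov

/-- Truncation of a function in `L^p` at the level `c ≥ 0` from above. -/
noncomputable def truncAbove (c : ℝ≥0) : Lp ℝ p m → Lp ℝ p m :=
  (LipschitzWith.id.min_const (c : ℝ)).compLp (min_eq_left c.2)

omit [Fact (1 ≤ p)] in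
theorem coeFn_truncAbove (c : ℝ≥0) (f : Lp ℝ p m) :
    truncAbove c f =ᵐ[m] fun x => min (f x) c :=
  LipschitzWith.coeFn_compLp _ _ _

theorem continuous_truncAbove (c : ℝ≥0) : Continuous (truncAbove c : Lp ℝ p m → Lp ℝ p m) :=
  LipschitzWith.continuous_compLp _ _

namespace AgreeOnInter

variable {T : Lp ℝ 2 m →L[ℝ] Lp ℝ 2 m} {S : Lp ℝ p m →L[ℝ] Lp ℝ p m} (hTS : AgreeOnInter T S)
include hTS

theorem ext {S' : Lp ℝ p m →L[ℝ] Lp ℝ p m} (hp : p ≠ ∞) (hTS' : AgreeOnInter T S') : S = S' := by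
  refine ContinuousLinearMap.ext fun f => congrFun
    (Continuous.ext_on (dense_memLp_two hp) S.continuous S'.continuous fun v hv => ?_) f
  exact Lp.ext ((hTS (MemLp.toLp v hv) v (MemLp.coeFn_toLp hv)).symm.trans
    (hTS' (MemLp.toLp v hv) v (MemLp.coeFn_toLp hv)))

omit hTS in
theorem comp {T T' : Lp ℝ 2 m →L[ℝ] Lp ℝ 2 m} {S S' : Lp ℝ p m →L[ℝ] Lp ℝ p m}
    (h : AgreeOnInter T S) (h' : AgreeOnInter T' S') : AgreeOnInter (T.comp T') (S.comp S') :=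
  fun u v huv => h _ _ (h' u v huv)

variable (hT : IsSymmetricMarkov T)
include hT

theorem norm_le [SigmaFinite m] (hp : p ≠ ∞) (f : Lp ℝ p m) : ‖S f‖ ≤ ‖f‖ := by
  refine (dense_memLp_two hp).induction (P := fun f => ‖S f‖ ≤ ‖f‖) (fun v hv => ?_)
    (isClosed_le S.continuous.norm continuous_norm) f
  have h1 := MemLp.coeFn_toLp hv
  have h2 := hT.eLpNorm_le hp ((memLp_congr_ae h1).2 (Lp.memLp v))
  rw [eLpNorm_congr_ae (hTS _ v h1), eLpNorm_congr_ae h1] at h2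
  rw [Lp.norm_def, Lp.norm_def]
  exact ENNReal.toReal_mono (Lp.eLpNorm_ne_top _) h2

theorem nonneg (hp : p ≠ ∞) {f : Lp ℝ p m} (hf : 0 ≤ f) : 0 ≤ S f := by
  refine Lp_nonneg_induction (P := fun f => 0 ≤ S f) hp
    (isClosed_le continuous_const S.continuous) (fun s hs hs0 => ?_) hf
  have hs2 : MemLp s 2 m := SimpleFunc_memLp_of_memLp (zero_lt_one.trans_le Fact.out).ne' hp
    (by simp) (by simp) hs
  have h1 := hTS (hs2.toLp s) (hs.toLp s) (hs2.coeFn_toLp.trans hs.coeFn_toLp.symm)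
  have h2 : 0 ≤ hs2.toLp s := by
    rw [← Lp.coeFn_nonneg]
    filter_upwards [hs2.coeFn_toLp] with x hx
    rw [hx]
    exact hs0 x
  rw [← Lp.coeFn_nonneg]
  exact ((Lp.coeFn_nonneg _).2 (hT.nonneg h2)).trans h1.le

theorem mono (hp : p ≠ ∞) {f g : Lp ℝ p m} (hfg : f ≤ g) : S f ≤ S g := by
  have := hTS.nonneg hT hp (sub_nonneg.2 hfg)
  rwa [map_sub, sub_nonneg] at this

/-- The extension maps functions with values in `[0, c]` to functions bounded by `c`. -/
theorem truncAbove_le (hp : p ≠ ∞) (c : ℝ≥0) {f : Lp ℝ p m} (hf : 0 ≤ f) :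
    ∀ᵐ x ∂m, S (truncAbove c f) x ≤ c := by
  have hcl : IsClosed {g : Lp ℝ p m | ∀ᵐ x ∂m, g x ≤ c} := by
    refine IsSeqClosed.isClosed fun f g hf hfg => ?_
    exact ae_mem_of_tendsto_Lp isClosed_Iic hfg hf
  refine Lp_nonneg_induction (P := fun f => ∀ᵐ x ∂m, S (truncAbove c f) x ≤ c) hp
    (hcl.preimage (S.continuous.comp (continuous_truncAbove c))) (fun s hs hs0 => ?_) hf
  have hs2 : MemLp (s.map (min · (c : ℝ))) 2 m :=
    SimpleFunc_memLp_map (by simp) (by simp) (min_eq_left c.2)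
      (SimpleFunc_memLp_of_memLp (zero_lt_one.trans_le Fact.out).ne' hp (by simp) (by simp) hs)
  have h1 := hTS (hs2.toLp _) (truncAbove c (hs.toLp s)) (by
    filter_upwards [hs2.coeFn_toLp, hs.coeFn_toLp, coeFn_truncAbove c (hs.toLp s)] with x e1 e2 e3
    rw [e1, e3, e2]
    rfl)
  have h2 := hT.le_const c.2 (f := hs2.toLp _) (by
    filter_upwards [hs2.coeFn_toLp] with x e1
    rw [e1]
    exact ⟨le_min (hs0 x) c.2, min_le_right _ _⟩)
  filter_upwards [h1, h2] with x e1 e2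
  rw [← e1]
  exact e2.2

end AgreeOnInter
end LpExtension

/-! ### Fixed vectors and invariant sets -/

section FixedVectors

variable {X : Type*} [MeasurableSpace X] {m : Measure X} {p : ℝ≥0∞} [Fact (1 ≤ p)]

/-- The `L^p` norm, `p < ∞`, is strictly monotone on nonnegative functions. -/
theorem Lp_eq_of_le_of_norm_le (hp : p ≠ ∞) {a b : Lp ℝ p m} (h0 : 0 ≤ a) (hab : a ≤ b)
    (hn : ‖b‖ ≤ ‖a‖) : a = b := by
  have hp0 : p ≠ 0 := (zero_lt_one.trans_le Fact.out).ne'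
  have hr : 0 < p.toReal := ENNReal.toReal_pos hp0 hp
  have h0' := (Lp.coeFn_nonneg _).2 h0
  have hab' := (Lp.coeFn_le _ _).2 hab
  rw [Lp.norm_def, Lp.norm_def, ENNReal.toReal_le_toReal (Lp.eLpNorm_ne_top _)
    (Lp.eLpNorm_ne_top _), eLpNorm_eq_lintegral_rpow_enorm_toReal hp0 hp,
    eLpNorm_eq_lintegral_rpow_enorm_toReal hp0 hp, ENNReal.rpow_le_rpow_iff (by positivity)] at hn
  have hle : (fun x => ‖a x‖ₑ ^ p.toReal) ≤ᵐ[m] fun x => ‖b x‖ₑ ^ p.toReal := by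
    filter_upwards [h0', hab'] with x h1 h2
    rw [Real.enorm_of_nonneg h1, Real.enorm_of_nonneg (h1.trans h2)]
    gcongr
  have hae := ae_eq_of_ae_le_of_lintegral_le hle
    (lintegral_rpow_enorm_lt_top_of_eLpNorm_lt_top hp0 hp (Lp.eLpNorm_lt_top a)).ne
    ((Lp.aestronglyMeasurable b).enorm.pow_const _) hn
  refine Lp.ext ?_
  filter_upwards [hae, h0', hab'] with x h1 h2 h3
  have h4 := ENNReal.rpow_left_injective hr.ne' h1
  rw [Real.enorm_of_nonneg h2, Real.enorm_of_nonneg (h2.trans h3)] at h4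
  exact (ENNReal.ofReal_eq_ofReal_iff h2 (h2.trans h3)).1 h4

namespace AgreeOnInter

variable {T : Lp ℝ 2 m →L[ℝ] Lp ℝ 2 m} {S : Lp ℝ p m →L[ℝ] Lp ℝ p m} (hTS : AgreeOnInter T S)
  (hT : IsSymmetricMarkov T) (hp : p ≠ ∞)
include hTS hT hp

/-- A subharmonic `a ≥ 0` is fixed, because `S` does not increase its norm. -/
theorem fixed_of_le [SigmaFinite m] {a : Lp ℝ p m} (h0 : 0 ≤ a) (h : a ≤ S a) : S a = a :=
  (Lp_eq_of_le_of_norm_le hp h0 h (hTS.norm_le hT hp a)).symm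

theorem abs_fixed [SigmaFinite m] {f : Lp ℝ p m} (hf : S f = f) : S |f| = |f| := by
  refine hTS.fixed_of_le hT hp (abs_nonneg f) (abs_le'.2 ⟨?_, ?_⟩)
  · nth_rewrite 1 [← hf]
    exact hTS.mono hT hp (le_abs_self f)
  · nth_rewrite 1 [← hf]
    rw [← map_neg]
    exact hTS.mono hT hp (neg_le_abs f)

/-- If `f ≥ 0` is fixed, then `f ∧ c` is superharmonic, so that `(f - c)⁺ = f - f ∧ c` is
subharmonic and hence fixed. -/
theorem sub_truncAbove_fixed [SigmaFinite m] {f : Lp ℝ p m} (hf0 : 0 ≤ f) (hf : S f = f)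
    (c : ℝ≥0) : S (f - truncAbove c f) = f - truncAbove c f := by
  have hle : truncAbove c f ≤ f := by
    rw [← Lp.coeFn_le]
    filter_upwards [coeFn_truncAbove c f] with x hx
    rw [hx]
    exact min_le_left _ _
  refine hTS.fixed_of_le hT hp (sub_nonneg.2 hle) ?_
  rw [map_sub, hf]
  refine sub_le_sub_left ?_ f
  have h1 := hTS.mono hT hp hle
  rw [hf, ← Lp.coeFn_le] at h1
  rw [← Lp.coeFn_le]
  filter_upwards [h1, hTS.truncAbove_le hT hp c hf0, coeFn_truncAbove c f] with x h2 h3 h4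
  rw [h4]
  exact le_min h2 h3

/-- For a fixed function `g ≥ 0` the functions vanishing on `A = {g > 0}` form an invariant
subspace: for `k ≥ 0` vanishing on `A` and `u = T k ∧ g`, the function `T u ≤ S g = g` vanishes off
`A`, whence `⟨u, T k⟩ = ⟨T u, k⟩ = 0`. -/
theorem eq_zero_on_of_nonneg {g : Lp ℝ p m} (hg0 : 0 ≤ g) (hg : S g = g) {k : Lp ℝ 2 m}
    (hk0 : 0 ≤ k) (hk : ∀ᵐ x ∂m, 0 < g x → k x = 0) : ∀ᵐ x ∂m, 0 < g x → T k x = 0 := by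
  have hTk := (Lp.coeFn_nonneg _).2 (hT.nonneg hk0)
  have hg0' := (Lp.coeFn_nonneg _).2 hg0
  have hmeas : AEStronglyMeasurable (fun x => min (T k x) (g x)) m :=
    (Lp.aestronglyMeasurable (T k)).inf (Lp.aestronglyMeasurable g)
  have h2 : MemLp (fun x => min (T k x) (g x)) 2 m := by
    refine (Lp.memLp (T k)).mono hmeas ?_
    filter_upwards [hTk, hg0'] with x e1 e2
    rw [Real.norm_of_nonneg (le_min e1 e2), Real.norm_of_nonneg e1]
    exact min_le_left _ _
  have hpm : MemLp (fun x => min (T k x) (g x)) p m := by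
    refine (Lp.memLp g).mono hmeas ?_
    filter_upwards [hTk, hg0'] with x e1 e2
    rw [Real.norm_of_nonneg (le_min e1 e2), Real.norm_of_nonneg e2]
    exact min_le_right _ _
  have hV : hpm.toLp _ ≤ g := by
    rw [← Lp.coeFn_le]
    filter_upwards [hpm.coeFn_toLp] with x e
    rw [e]
    exact min_le_right _ _
  have hU : 0 ≤ h2.toLp _ := by
    rw [← Lp.coeFn_nonneg]
    filter_upwards [h2.coeFn_toLp, hTk, hg0'] with x e e1 e2
    rw [e]
    exact le_min e1 e2
  have hSV := hTS.mono hT hp hV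
  rw [hg, ← Lp.coeFn_le] at hSV
  have hagree := hTS (h2.toLp _) (hpm.toLp _) (h2.coeFn_toLp.trans hpm.coeFn_toLp.symm)
  have h3 : inner ℝ (T (h2.toLp _)) k = 0 := by
    rw [inner_L2_eq_integral]
    refine integral_eq_zero_of_ae ?_
    filter_upwards [hk, hSV, hagree, (Lp.coeFn_nonneg _).2 (hT.nonneg hU), hg0']
      with x e1 e2 e3 e4 e5
    rw [Pi.zero_apply]
    by_cases hx : 0 < g x
    · rw [e1 hx, mul_zero]
    · rw [← e3] at e2
      have : T (h2.toLp _) x = 0 := le_antisymm (e2.trans (not_lt.1 hx)) e4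
      rw [this, zero_mul]
  rw [hT.symm, inner_L2_eq_integral, integral_eq_zero_iff_of_nonneg_ae _ (integrable_mul_L2 _ _)]
    at h3
  · filter_upwards [h3, h2.coeFn_toLp, hTk] with x e1 e2 e3 hx
    rw [Pi.zero_apply, e2] at e1
    by_contra hne
    have h4 : 0 < T k x := lt_of_le_of_ne e3 (Ne.symm hne)
    have : 0 < min (T k x) (g x) * T k x := mul_pos (lt_min h4 hx) h4
    exact this.ne' e1
  · filter_upwards [(Lp.coeFn_nonneg _).2 hU, hTk] with x e1 e2
    exact mul_nonneg e1 e2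

/-- The same without the sign condition, by `|T k| ≤ T |k|`. -/
theorem eq_zero_on {g : Lp ℝ p m} (hg0 : 0 ≤ g) (hg : S g = g) {k : Lp ℝ 2 m}
    (hk : ∀ᵐ x ∂m, 0 < g x → k x = 0) : ∀ᵐ x ∂m, 0 < g x → T k x = 0 := by
  have h1 := hTS.eq_zero_on_of_nonneg hT hp hg0 hg (abs_nonneg k) (by
    filter_upwards [hk, Lp.coeFn_abs k] with x e1 e2 hx
    rw [e2, e1 hx, abs_zero])
  filter_upwards [h1, (Lp.coeFn_le _ _).2 (hT.abs_le k), Lp.coeFn_abs (T k)] with x e1 e2 e3 hx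
  rw [e3, e1 hx] at e2
  exact abs_nonpos_iff.1 e2

/-- The set where a nonnegative fixed function is positive is invariant. The previous lemma gives
that `T` preserves functions vanishing on the set, and by symmetry it preserves those vanishing
off the set. -/
theorem indicator_pos_commute {g : Lp ℝ p m} (hg0 : 0 ≤ g) (hg : S g = g) {f f' : Lp ℝ 2 m}
    (hf : (f' : X → ℝ) =ᵐ[m] {x | 0 < g x}.indicator f) :
    (T f' : X → ℝ) =ᵐ[m] {x | 0 < g x}.indicator (T f) := by
  have hA : MeasurableSet {x | 0 < g x} :=
    measurableSet_lt measurable_const (Lp.stronglyMeasurable g).measurable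
  have h1 := hTS.eq_zero_on hT hp hg0 hg (k := f - f') (by
    filter_upwards [hf, Lp.coeFn_sub f f'] with x e1 e2 hx
    have hx' : x ∈ {x | 0 < g x} := hx
    rw [e2, Pi.sub_apply, e1, Set.indicator_of_mem hx', sub_self])
  have hw : MemLp ({x | 0 < g x}ᶜ.indicator (T f')) 2 m := (Lp.memLp _).indicator hA.compl
  have h2 := hTS.eq_zero_on hT hp hg0 hg (k := hw.toLp _) (by
    filter_upwards [hw.coeFn_toLp] with x e1 hx
    rw [e1, Set.indicator_of_notMem (by simpa using hx)])
  have h3 : inner ℝ (T f') (hw.toLp _) = 0 := by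
    rw [hT.symm, inner_L2_eq_integral]
    refine integral_eq_zero_of_ae ?_
    filter_upwards [h2, hf] with x e1 e2
    rw [Pi.zero_apply, e2]
    by_cases hx : 0 < g x
    · rw [e1 hx, mul_zero]
    · rw [Set.indicator_of_notMem (by simpa using hx), zero_mul]
  have h4 : hw.toLp _ = 0 := by
    refine (inner_self_eq_zero (𝕜 := ℝ)).1 (Eq.trans ?_ h3)
    rw [inner_L2_eq_integral, inner_L2_eq_integral]
    refine integral_congr_ae ?_
    filter_upwards [hw.coeFn_toLp] with x e1
    rw [e1]
    by_cases hx : 0 < g x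
    · rw [Set.indicator_of_notMem (by simpa using hx), mul_zero, mul_zero]
    · rw [Set.indicator_of_mem (by simpa using hx)]
  have h5 := hw.coeFn_toLp
  rw [h4] at h5
  rw [map_sub] at h1
  filter_upwards [h1, h5, Lp.coeFn_sub (T f) (T f'), Lp.coeFn_zero ℝ 2 m] with x e1 e2 e3 e4
  by_cases hx : 0 < g x
  · have hx' : x ∈ {x | 0 < g x} := hx
    rw [Set.indicator_of_mem hx']
    have := e1 hx
    rw [e3, Pi.sub_apply, sub_eq_zero] at this
    exact this.symm
  · rw [Set.indicator_of_notMem (by simpa using hx)]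
    rw [Set.indicator_of_mem (by simpa using hx), e4] at e2
    exact e2.symm

end AgreeOnInter

omit [Fact (1 ≤ p)] in
/-- A nonnegative function all of whose superlevel sets are null or conull is constant. -/
theorem ae_const_of_superlevel {f : X → ℝ} (hf0 : 0 ≤ᵐ[m] f)
    (h : ∀ c : ℝ≥0, m {x | (c : ℝ) < f x} = 0 ∨ m {x | (c : ℝ) < f x}ᶜ = 0) :
    ∃ a, f =ᵐ[m] fun _ => a := by
  have : HasCountableSeparatingOn ℝ (fun U => ∃ c : ℝ≥0, U = Set.Ioi (c : ℝ)) (Set.Ici 0) := by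
    refine ⟨Set.range fun q : ℚ => Set.Ioi ((q : ℝ).toNNReal : ℝ), Set.countable_range _, ?_, ?_⟩
    · rintro _ ⟨q, rfl⟩
      exact ⟨_, rfl⟩
    · have aux : ∀ x y : ℝ, 0 ≤ x → x < y →
          ¬ ∀ s ∈ Set.range fun q : ℚ => Set.Ioi ((q : ℝ).toNNReal : ℝ), x ∈ s ↔ y ∈ s := by
        intro x y hx hxy hs
        obtain ⟨q, hq1, hq2⟩ := exists_rat_btwn hxy
        have h2 := hs _ ⟨q, rfl⟩
        beta_reduce at h2
        rw [Real.coe_toNNReal _ (hx.trans hq1.le)] at h2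
        exact lt_asymm (h2.2 hq2) hq1
      intro x hx y hy hs
      rcases lt_trichotomy x y with hxy | hxy | hxy
      · exact absurd hs (aux x y hx hxy)
      · exact hxy
      · exact absurd (fun s h => (hs s h).symm) (aux y x hy hxy)
  refine exists_eventuallyEq_const_of_eventually_mem_of_forall_separating
    (fun U => ∃ c : ℝ≥0, U = Set.Ioi (c : ℝ)) (s := Set.Ici 0) hf0 ?_
  rintro _ ⟨c, rfl⟩
  rcases h c with h | h
  · right
    rw [ae_iff]
    simpa using h
  · left
    exact h

namespace DirichletForm

variable [SigmaFinite m] {E : DirichletForm m}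

/-- Irreducibility applied to the positivity sets `{f > c}` of the fixed functions `(f - c)⁺`. -/
theorem IsIrreducible.ae_const_of_nonneg (hE : E.IsIrreducible) (hp : p ≠ ∞)
    {S : ℝ≥0 → Lp ℝ p m →L[ℝ] Lp ℝ p m} (hS : ∀ t, AgreeOnInter (E.semigroup t) (S t))
    {f : Lp ℝ p m} (hf0 : 0 ≤ f) (hf : ∀ t, S t f = f) : ∃ c : ℝ, (f : X → ℝ) =ᵐ[m] fun _ => c := by
  refine ae_const_of_superlevel ((Lp.coeFn_nonneg _).2 hf0) fun c => ?_
  set g := f - truncAbove c f with hgdef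
  have hgae : ∀ᵐ x ∂m, g x = f x - min (f x) c := by
    filter_upwards [Lp.coeFn_sub f (truncAbove c f), coeFn_truncAbove c f] with x h1 h2
    rw [h1, Pi.sub_apply, h2]
  have hg0 : 0 ≤ g := by
    rw [← Lp.coeFn_nonneg]
    filter_upwards [hgae] with x hx
    rw [hx]
    exact sub_nonneg.2 (min_le_left _ _)
  have hset : {x | (c : ℝ) < f x} =ᵐ[m] {x | 0 < g x} := by
    filter_upwards [hgae] with x hx
    refine propext ?_
    change (c : ℝ) < f x ↔ 0 < g x
    rw [hx, sub_pos, min_lt_iff]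
    simp
  have hinv : E.IsInvariantSet {x | 0 < g x} :=
    ⟨measurableSet_lt measurable_const (Lp.stronglyMeasurable g).measurable, fun t h h' hh =>
      (hS t).indicator_pos_commute (E.isSymmetricMarkov_semigroup t) hp hg0
        ((hS t).sub_truncAbove_fixed (E.isSymmetricMarkov_semigroup t) hp hf0 (hf t) c) hh⟩
  rw [measure_congr hset, measure_congr hset.compl]
  exact hE _ hinv

theorem IsIrreducible.ae_const (hE : E.IsIrreducible) (hp : p ≠ ∞)
    {S : ℝ≥0 → Lp ℝ p m →L[ℝ] Lp ℝ p m} (hS : ∀ t, AgreeOnInter (E.semigroup t) (S t))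
    {f : Lp ℝ p m} (hf : ∀ t, S t f = f) : ∃ c : ℝ, (f : X → ℝ) =ᵐ[m] fun _ => c := by
  have habs : ∀ t, S t |f| = |f| := fun t =>
    (hS t).abs_fixed (E.isSymmetricMarkov_semigroup t) hp (hf t)
  -- `f = (|f| + f) - |f|` is a difference of nonnegative fixed functions.
  obtain ⟨a, ha⟩ := hE.ae_const_of_nonneg hp hS (abs_nonneg f) habs
  obtain ⟨b, hb⟩ := hE.ae_const_of_nonneg hp hS (f := |f| + f)
    (neg_le_iff_add_nonneg.1 (neg_le_abs f)) (fun t => by rw [map_add, habs, hf])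
  refine ⟨b - a, ?_⟩
  filter_upwards [ha, hb, Lp.coeFn_add |f| f] with x h1 h2 h3
  rw [h3, Pi.add_apply, h1] at h2
  linarith

omit [SigmaFinite m] in
theorem semigroup_zero : E.semigroup 0 = ContinuousLinearMap.id ℝ _ :=
  E.isAssociatedSemigroup_semigroup.1.zero

/-- A function in the kernel of the generator is fixed: `‖S_t f - f‖ ≤ n ‖S_{t/n} f - f‖`. -/
theorem fixed_of_generator (hp : p ≠ ∞)
    {S : ℝ≥0 → Lp ℝ p m →L[ℝ] Lp ℝ p m} (hS : ∀ t, AgreeOnInter (E.semigroup t) (S t))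
    {f : Lp ℝ p m} (hf : SemigroupGenerator S f 0) (t : ℝ≥0) : S t f = f := by
  have h0 : S 0 = ContinuousLinearMap.id ℝ _ := by
    refine (hS 0).ext hp fun u v huv => ?_
    rw [semigroup_zero]
    exact huv
  have hadd : ∀ s t, S (s + t) = (S s).comp (S t) := fun s t => by
    refine (hS (s + t)).ext hp ?_
    rw [E.isAssociatedSemigroup_semigroup.1.add]
    exact (hS s).comp (hS t)
  have hn : ∀ (n : ℕ) (h : ℝ≥0), ‖S (n * h) f - f‖ ≤ n * ‖S h f - f‖ := by
    intro n h
    induction n with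
    | zero => simp [h0]
    | succ n ih =>
      have e : S ((n + 1 : ℕ) * h) f - f = S h (S (n * h) f - f) + (S h f - f) := by
        rw [map_sub, Nat.cast_add, Nat.cast_one, add_mul, one_mul, add_comm, hadd,
          ContinuousLinearMap.comp_apply]
        abel
      rw [e]
      have h1 := norm_add_le (S h (S (n * h) f - f)) (S h f - f)
      have h2 := (hS h).norm_le (E.isSymmetricMarkov_semigroup h) hp (S (n * h) f - f)
      push_cast
      linarith
  rcases eq_or_ne t 0 with rfl | ht
  · rw [h0]; rfl
  have ht' : 0 < t := pos_iff_ne_zero.2 ht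
  have hlim : Tendsto (fun n : ℕ => t / ((n : ℝ≥0) + 1)) atTop (𝓝[>] 0) := by
    refine tendsto_nhdsWithin_iff.2 ⟨?_, Eventually.of_forall fun n => ?_⟩
    · rw [← NNReal.tendsto_coe]
      have := tendsto_one_div_add_atTop_nhds_zero_nat (𝕜 := ℝ)
      have := this.const_mul (t : ℝ)
      simpa [div_eq_mul_inv] using this
    · exact div_pos ht' (by positivity)
  have h1 := ((Tendsto.comp hf hlim).norm).const_mul (t : ℝ)
  rw [norm_zero, mul_zero] at h1
  have h2 : ‖S t f - f‖ ≤ 0 := by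
    refine ge_of_tendsto h1 (Eventually.of_forall fun n => ?_)
    have hpos : (0 : ℝ) < (n : ℝ) + 1 := by positivity
    have htp : (0 : ℝ) < t := by exact_mod_cast ht'
    have h3 := hn (n + 1) (t / ((n : ℝ≥0) + 1))
    have e1 : (((n + 1 : ℕ) : ℝ≥0)) * (t / ((n : ℝ≥0) + 1)) = t := by
      rw [Nat.cast_add, Nat.cast_one, mul_div_cancel₀]
      positivity
    rw [e1] at h3
    refine h3.trans (le_of_eq ?_)
    simp only [Function.comp_apply]
    rw [norm_smul, norm_sub_rev f, norm_inv, Real.norm_of_nonneg (NNReal.coe_nonneg _)]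
    push_cast
    field_simp
  exact sub_eq_zero.1 (norm_le_zero_iff.1 h2)

end DirichletForm
end FixedVectors

/-! ### Finite measures and conservativeness -/

section FiniteMeasure

variable {X : Type*} [MeasurableSpace X] {m : Measure X}

/-- On a finite measure space `L^∞ ⊆ L²`, so the extension to `L^∞` is the restriction of the
operator, and its preadjoint is the extension to `L¹`. -/
theorem IsSymmetricMarkov.exists_linfty [IsFiniteMeasure m] {T : Lp ℝ 2 m →L[ℝ] Lp ℝ 2 m}
    (hT : IsSymmetricMarkov T) :
    ∃ S : Lp ℝ ∞ m →L[ℝ] Lp ℝ ∞ m, AgreeOnInter T S ∧ IsWeakStarContinuous S := by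
  have h2 : ∀ f : Lp ℝ ∞ m, MemLp f 2 m := fun f => (Lp.memLp f).mono_exponent le_top
  have hnorm : ∀ f : Lp ℝ ∞ m, ∀ᵐ x ∂m, ‖f x‖ ≤ ‖f‖ := fun f => by
    filter_upwards [ae_le_eLpNormEssSup (f := f) (μ := m)] with x hx
    rw [Lp.norm_def, eLpNorm_exponent_top, ← toReal_enorm]
    refine ENNReal.toReal_mono ?_ hx
    rw [← eLpNorm_exponent_top]
    exact Lp.eLpNorm_ne_top f
  have hbd : ∀ f : Lp ℝ ∞ m, ∀ᵐ x ∂m, ‖T ((h2 f).toLp _) x‖ ≤ ‖f‖ := by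
    intro f
    have h1 := hT.le_const (norm_nonneg f) (f := |(h2 f).toLp _|) (by
      filter_upwards [Lp.coeFn_abs ((h2 f).toLp _), (h2 f).coeFn_toLp,
        hnorm f] with x e1 e2 e3
      rw [e1, e2]
      exact ⟨abs_nonneg _, e3⟩)
    filter_upwards [h1, (Lp.coeFn_le _ _).2 (hT.abs_le ((h2 f).toLp _)),
      Lp.coeFn_abs (T ((h2 f).toLp _))] with x e1 e2 e3
    rw [e3] at e2
    exact e2.trans e1.2
  have hmem : ∀ f : Lp ℝ ∞ m, MemLp (T ((h2 f).toLp _)) ∞ m := fun f =>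
    memLp_top_of_bound (Lp.aestronglyMeasurable _) _ (hbd f)
  have hadd : ∀ f g : Lp ℝ ∞ m, (h2 (f + g)).toLp _ = (h2 f).toLp _ + (h2 g).toLp _ := by
    intro f g
    refine Lp.ext ?_
    filter_upwards [(h2 (f + g)).coeFn_toLp, (h2 f).coeFn_toLp, (h2 g).coeFn_toLp,
      Lp.coeFn_add ((h2 f).toLp _) ((h2 g).toLp _), Lp.coeFn_add f g] with x e1 e2 e3 e4 e5
    rw [e1, e4, Pi.add_apply, e2, e3, e5, Pi.add_apply]
  have hsmul : ∀ (c : ℝ) (f : Lp ℝ ∞ m), (h2 (c • f)).toLp _ = c • (h2 f).toLp _ := by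
    intro c f
    refine Lp.ext ?_
    filter_upwards [(h2 (c • f)).coeFn_toLp, (h2 f).coeFn_toLp,
      Lp.coeFn_smul c ((h2 f).toLp _), Lp.coeFn_smul c f] with x e1 e2 e4 e5
    rw [e1, e4, Pi.smul_apply, e2, e5, Pi.smul_apply]
  let S₀ : Lp ℝ ∞ m →ₗ[ℝ] Lp ℝ ∞ m :=
    { toFun := fun f => (hmem f).toLp _
      map_add' := fun f g => by
        refine Lp.ext ?_
        filter_upwards [(hmem (f + g)).coeFn_toLp, (hmem f).coeFn_toLp, (hmem g).coeFn_toLp,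
          Lp.coeFn_add ((hmem f).toLp _) ((hmem g).toLp _),
          Lp.coeFn_add (T ((h2 f).toLp _)) (T ((h2 g).toLp _))] with x e1 e2 e3 e4 e5
        rw [e1, e4, Pi.add_apply, e2, e3, hadd, map_add, e5, Pi.add_apply]
      map_smul' := fun c f => by
        refine Lp.ext ?_
        filter_upwards [(hmem (c • f)).coeFn_toLp, (hmem f).coeFn_toLp,
          Lp.coeFn_smul c ((hmem f).toLp _), Lp.coeFn_smul c (T ((h2 f).toLp _))]
          with x e1 e2 e4 e5
        rw [e1, RingHom.id_apply, e4, Pi.smul_apply, e2, hsmul, map_smul, e5, Pi.smul_apply] }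
  let S : Lp ℝ ∞ m →L[ℝ] Lp ℝ ∞ m := S₀.mkContinuous 1 fun f => by
    rw [one_mul]
    rw [Lp.norm_def, eLpNorm_exponent_top]
    refine ENNReal.toReal_le_of_le_ofReal (norm_nonneg f) (eLpNormEssSup_le_of_ae_bound ?_)
    filter_upwards [(hmem f).coeFn_toLp, hbd f] with x e1 e2
    exact (congrArg norm e1).le.trans e2
  have hSae : ∀ f : Lp ℝ ∞ m, (S f : X → ℝ) =ᵐ[m] T ((h2 f).toLp _) := fun f => (hmem f).coeFn_toLp
  refine ⟨S, fun u v huv => ?_, ?_⟩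
  · have e : (h2 v).toLp _ = u := Lp.ext ((h2 v).coeFn_toLp.trans huv.symm)
    have h := hSae v
    rw [e] at h
    exact h.symm
  · obtain ⟨S₁, hS₁⟩ := hT.exists_agreeOnInter (p := 1) (by simp)
    refine ⟨S₁, fun f g => ?_⟩
    have hpair : ∀ (f : Lp ℝ ∞ m) (g : Lp ℝ 1 m),
        ∫ x, f x * g x ∂m = (ContinuousLinearMap.mul ℝ ℝ).lpPairing m ∞ 1 f g := fun f g => by
      rw [ContinuousLinearMap.lpPairing_eq_integral]
      rfl
    refine (dense_memLp_two (p := 1) (m := m) (by simp)).induction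
      (P := fun g => ∫ x, S f x * g x ∂m = ∫ x, f x * S₁ g x ∂m) (fun g hg => ?_) ?_ g
    · have hg' := MemLp.coeFn_toLp hg
      have h1 := hT.symm ((h2 f).toLp _) (MemLp.toLp g hg)
      rw [inner_L2_eq_integral, inner_L2_eq_integral] at h1
      calc ∫ x, S f x * g x ∂m
          = ∫ x, T ((h2 f).toLp _) x * MemLp.toLp g hg x ∂m := by
            refine integral_congr_ae ?_
            filter_upwards [hSae f, hg'] with x e1 e2
            rw [e1, e2]
        _ = ∫ x, (h2 f).toLp _ x * T (MemLp.toLp g hg) x ∂m := h1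
        _ = ∫ x, f x * S₁ g x ∂m := by
            refine integral_congr_ae ?_
            filter_upwards [(h2 f).coeFn_toLp, hS₁ _ g hg'] with x e1 e2
            rw [e1, e2]
    · simp only [hpair]
      exact isClosed_eq (ContinuousLinearMap.continuous _)
        ((ContinuousLinearMap.continuous _).comp S₁.continuous)

namespace DirichletForm

variable {E : DirichletForm m}

/-- If `1 ∈ L²(m)` is fixed, then so is `1 ∈ L^∞(m)`, as the two extensions agree. -/
theorem isConservative_of_fixed [IsFiniteMeasure m] {u : Lp ℝ 2 m}
    (hu : (u : X → ℝ) =ᵐ[m] fun _ => 1) (hfix : ∀ t, E.semigroup t u = u) :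
    E.IsConservative := by
  intro t
  have h := (E.isSymmetricMarkov_semigroup t).exists_linfty
  have hag : AgreeOnInter (E.semigroup t) (E.linftySemigroup t) := by
    rw [linftySemigroup, dif_pos h]
    exact h.choose_spec.1
  have hone := (memLp_top_const (μ := m) (1 : ℝ)).coeFn_toLp
  refine Lp.ext ((hag u _ (hu.trans hone.symm)).symm.trans ?_)
  rw [hfix]
  exact hu.trans hone.symm

theorem agreeOnInter_lpSemigroup [SigmaFinite m] {p : ℝ≥0∞} [Fact (1 ≤ p)] (hp : p ≠ ∞) (t : ℝ≥0) :
    AgreeOnInter (E.semigroup t) (E.lpSemigroup p t) := by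
  have h := (E.isSymmetricMarkov_semigroup t).exists_agreeOnInter (p := p) hp
  rw [lpSemigroup, dif_pos h]
  exact h.choose_spec

theorem agreeOnInter_self (T : Lp ℝ 2 m →L[ℝ] Lp ℝ 2 m) : AgreeOnInter T T := fun u v huv => by
  rw [Lp.ext huv]

theorem generator_zero_iff_fixed [SigmaFinite m] {u : Lp ℝ 2 m} :
    E.Generator u 0 ↔ ∀ t, E.semigroup t u = u := by
  rw [← E.isAssociatedSemigroup_semigroup.2]
  refine ⟨fun h => fixed_of_generator (by simp) (fun t => agreeOnInter_self _) h, fun h => ?_⟩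
  simp only [SemigroupGenerator, h, sub_self, smul_zero]
  exact tendsto_const_nhds

theorem IsIrreducible.ae_const_of_isLpHarmonic [SigmaFinite m] (hE : E.IsIrreducible)
    {p : ℝ≥0∞} [Fact (1 ≤ p)] (hp : p ≠ ∞) {f : Lp ℝ p m} (hf : E.IsLpHarmonic p f) :
    ∃ c : ℝ, (f : X → ℝ) =ᵐ[m] fun _ => c :=
  hE.ae_const hp (fun t => agreeOnInter_lpSemigroup hp t)
    (fixed_of_generator hp (fun t => agreeOnInter_lpSemigroup hp t) hf)

theorem IsIrreducible.ae_const_of_generator_zero [SigmaFinite m] (hE : E.IsIrreducible)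
    {u : Lp ℝ 2 m} (hu : E.Generator u 0) : ∃ c : ℝ, (u : X → ℝ) =ᵐ[m] fun _ => c :=
  hE.ae_const (by simp) (fun t => agreeOnInter_self _) (generator_zero_iff_fixed.1 hu)

end DirichletForm

/-- A nonzero constant in `L^p`, `p < ∞`, forces `0 < m(X) < ∞`. -/
theorem measure_univ_of_const {p : ℝ≥0∞} [Fact (1 ≤ p)] (hp : p ≠ ∞) {f : Lp ℝ p m} (hf : f ≠ 0)
    {c : ℝ} (hc : (f : X → ℝ) =ᵐ[m] fun _ => c) :
    c ≠ 0 ∧ m Set.univ ≠ 0 ∧ m Set.univ < ∞ := by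
  have hc0 : c ≠ 0 := by
    rintro rfl
    exact hf (Lp.ext (hc.trans (Lp.coeFn_zero ℝ p m).symm))
  refine ⟨hc0, fun h => ?_, ?_⟩
  · rw [Measure.measure_univ_eq_zero] at h
    exact hf (Lp.ext (by simp [Filter.EventuallyEq, h]))
  · have := (memLp_congr_ae hc).1 (Lp.memLp f)
    rw [memLp_const_iff (zero_lt_one.trans_le Fact.out).ne' hp] at this
    exact this.resolve_left hc0

theorem norm_sq_of_const {u : Lp ℝ 2 m} {c : ℝ} (hc : (u : X → ℝ) =ᵐ[m] fun _ => c) :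
    ‖u‖ ^ 2 = c ^ 2 * m.real Set.univ := by
  rw [← real_inner_self_eq_norm_sq, inner_L2_eq_integral]
  have : (fun x => u x * u x) =ᵐ[m] fun _ => c * c := by
    filter_upwards [hc] with x hx
    rw [hx]
  rw [integral_congr_ae this, integral_const, smul_eq_mul]
  ring

namespace DirichletForm

variable {E : DirichletForm m}

/-- A nonzero constant harmonic function makes the constant `1` a fixed vector in `L²(m)`. -/
theorem fixed_one_of_isLpHarmonic [IsFiniteMeasure m] {p : ℝ≥0∞} [Fact (1 ≤ p)] (hp : p ≠ ∞)
    {f : Lp ℝ p m} (hf : E.IsLpHarmonic p f) {c : ℝ} (hc : (f : X → ℝ) =ᵐ[m] fun _ => c)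
    (hc0 : c ≠ 0) {u : Lp ℝ 2 m} (hu : (u : X → ℝ) =ᵐ[m] fun _ => 1) (t : ℝ≥0) :
    E.semigroup t u = u := by
  have hfix := fixed_of_generator hp (fun t => agreeOnInter_lpSemigroup (E := E) hp t) hf t
  have hcu : ((c • u : Lp ℝ 2 m) : X → ℝ) =ᵐ[m] f := by
    filter_upwards [Lp.coeFn_smul c u, hu, hc] with x e1 e2 e3
    rw [e1, e3, Pi.smul_apply, e2, smul_eq_mul, mul_one]
  have h1 := agreeOnInter_lpSemigroup (E := E) hp t (c • u) f hcu
  rw [hfix] at h1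
  have h2 : E.semigroup t (c • u) = c • u := Lp.ext (h1.trans hcu.symm)
  rw [map_smul] at h2
  exact smul_right_injective _ hc0 h2

/-- The ground state is unique, as a positive constant is determined by its norm. -/
theorem IsGroundState.unique {Φ Ψ : Lp ℝ 2 m} (hΦ : E.IsGroundState Φ) (hΨ : E.IsGroundState Ψ) :
    Φ = Ψ := by
  rcases hΦ with ⟨h0, rfl⟩ | ⟨h0, -, hn, c, hc, hΦc⟩
  · rcases hΨ with ⟨-, rfl⟩ | ⟨h1, -⟩
    · rfl
    · exact absurd h1 h0
  · rcases hΨ with ⟨h1, -⟩ | ⟨-, -, hn', c', hc', hΨc⟩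
    · exact absurd h0 h1
    · have h1 := norm_sq_of_const hΦc
      have h2 := norm_sq_of_const hΨc
      rw [hn] at h1
      rw [hn'] at h2
      have h3 : m.real Set.univ ≠ 0 := fun h => by simp [h] at h1
      have h4 : c ^ 2 = c' ^ 2 := mul_right_cancel₀ h3 (h1.symm.trans h2)
      have h5 : c = c' := (pow_left_inj₀ hc.le hc'.le two_ne_zero).1 h4
      rw [h5] at hΦc
      exact Lp.ext (hΦc.trans hΨc.symm)

/-- If `0` is an eigenvalue, then an eigenfunction is a nonzero constant, and the ground state is
`m(X)^(-1/2)`. -/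
theorem IsIrreducible.exists_isGroundState [SigmaFinite m] (hE : E.IsIrreducible) :
    ∃ Φ : Lp ℝ 2 m, E.IsGroundState Φ := by
  by_cases h0 : E.ZeroIsEigenvalue
  · obtain ⟨u, hu0, hu⟩ := h0
    obtain ⟨a, ha⟩ := hE.ae_const_of_generator_zero hu
    obtain ⟨ha0, -, -⟩ := measure_univ_of_const (by simp) hu0 ha
    have hnu : ‖u‖ ≠ 0 := norm_ne_zero_iff.2 hu0
    have hfix := generator_zero_iff_fixed.1 hu
    -- The factor `|a| / a` is the sign of the constant `a`.
    set b := ‖u‖⁻¹ * (|a| / a) with hb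
    have hba : b * a = ‖u‖⁻¹ * |a| := by rw [hb]; field_simp
    have habs : |(|a| / a)| = 1 := by
      rw [abs_div, abs_abs, div_self (abs_ne_zero.2 ha0)]
    refine ⟨b • u, Or.inr ⟨⟨u, hu0, hu⟩, generator_zero_iff_fixed.2 fun t => by
      rw [map_smul, hfix], ?_, b * a, ?_, ?_⟩⟩
    · rw [norm_smul, hb, norm_mul, norm_inv, norm_norm, Real.norm_eq_abs, habs, mul_one,
        inv_mul_cancel₀ hnu]
    · rw [hba]
      have := abs_pos.2 ha0
      positivity
    · filter_upwards [Lp.coeFn_smul b u, ha] with x e1 e2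
      rw [e1, Pi.smul_apply, e2, smul_eq_mul]
  · exact ⟨0, Or.inl ⟨h0, rfl⟩⟩

end DirichletForm
end FiniteMeasure

theorem theorem1p1 {X : Type*} [MeasurableSpace X] (m : Measure X) [SigmaFinite m]
    (E : DirichletForm m) (hE : E.IsIrreducible)
    (p : ℝ≥0∞) [Fact (1 ≤ p)] (hp : 1 < p) (hp' : p < ∞) :
    (∃! Φ : Lp ℝ 2 m, E.IsGroundState Φ) ∧
    ∀ f : Lp ℝ p m, E.IsLpHarmonic p f →
      (∃ c : ℝ, (f : X → ℝ) =ᵐ[m] fun _ => c) ∧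
      (∀ Φ : Lp ℝ 2 m, E.IsGroundState Φ →
        Integrable (fun y => Φ y * f y) m ∧
          (f : X → ℝ) =ᵐ[m] fun x => (∫ y, Φ y * f y ∂m) * Φ x) ∧
      (m Set.univ < ∞ ∧ E.IsConservative →
        Integrable (f : X → ℝ) m ∧
          (f : X → ℝ) =ᵐ[m] fun _ => (m.real Set.univ)⁻¹ * ∫ y, f y ∂m) ∧
      (¬ (m Set.univ < ∞ ∧ E.IsConservative) → f = 0) ∧
      (f ≠ 0 → m Set.univ < ∞) := by
  obtain ⟨Φ₀, hΦ₀⟩ := hE.exists_isGroundState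
  refine ⟨⟨Φ₀, hΦ₀, fun Ψ hΨ => hΨ.unique hΦ₀⟩, fun f hf => ?_⟩
  obtain ⟨c, hc⟩ := hE.ae_const_of_isLpHarmonic hp'.ne hf
  refine ⟨⟨c, hc⟩, ?_⟩
  rcases eq_or_ne f 0 with rfl | hf0
  · have h0 := Lp.coeFn_zero ℝ p m
    refine ⟨fun Φ _ => ?_, fun _ => ?_, fun _ => rfl, fun h => absurd rfl h⟩
    · have h1 : (fun y => Φ y * (0 : Lp ℝ p m) y) =ᵐ[m] fun _ => 0 := by
        filter_upwards [h0] with x hx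
        rw [hx, Pi.zero_apply, mul_zero]
      refine ⟨(integrable_congr h1).2 (integrable_zero _ _ _), ?_⟩
      rw [integral_congr_ae h1, integral_zero]
      filter_upwards [h0] with x hx
      rw [hx, zero_mul, Pi.zero_apply]
    · refine ⟨(integrable_congr h0).2 (integrable_zero _ _ _), ?_⟩
      rw [integral_congr_ae h0]
      filter_upwards [h0] with x hx
      rw [hx]
      simp
  obtain ⟨hc0, hm0, hm⟩ := measure_univ_of_const hp'.ne hf0 hc
  have : IsFiniteMeasure m := ⟨hm⟩
  have hμ : m.real Set.univ ≠ 0 := (measureReal_ne_zero_iff hm.ne).2 hm0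
  have h1mem : MemLp (fun _ : X => (1 : ℝ)) 2 m := memLp_const 1
  set u := h1mem.toLp _
  have hu : (u : X → ℝ) =ᵐ[m] fun _ => 1 := h1mem.coeFn_toLp
  have hufix := DirichletForm.fixed_one_of_isLpHarmonic hp'.ne hf hc hc0 hu
  refine ⟨fun Φ hΦ => ?_, fun _ => ⟨(integrable_congr hc).2 (integrable_const c), ?_⟩,
    fun h => absurd ⟨hm, DirichletForm.isConservative_of_fixed hu hufix⟩ h, fun _ => hm⟩
  · have hev : E.ZeroIsEigenvalue := by
      refine ⟨u, fun h => ?_, DirichletForm.generator_zero_iff_fixed.2 hufix⟩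
      have h1 := norm_sq_of_const hu
      rw [h, norm_zero] at h1
      exact hμ (by linarith)
    rcases hΦ with ⟨h, -⟩ | ⟨-, -, hn, d, -, hd⟩
    · exact absurd hev h
    · have h1 : (fun y => Φ y * f y) =ᵐ[m] fun _ => d * c := by
        filter_upwards [hd, hc] with x e1 e2
        rw [e1, e2]
      refine ⟨(integrable_congr h1).2 (integrable_const _), ?_⟩
      rw [integral_congr_ae h1, integral_const, smul_eq_mul]
      have h2 := norm_sq_of_const hd
      rw [hn] at h2
      filter_upwards [hd, hc] with x e1 e2
      rw [e1, e2]
      linear_combination c * h2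
  · rw [integral_congr_ae hc, integral_const, smul_eq_mul, inv_mul_cancel_left₀ hμ]
    exact hc
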